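/- Conventions. Let $X$ be a normal integral locally Noetherian scheme. A Weil divisor (resp. $\mathbb{Q}$-divisor) on $X$ is a locally finite $\mathbb{Z}$-linear (resp. $\mathbb{Q}$-linear) combination of prime divisors. For a Weil divisor $E$, $\mathcal{O}_X(E)$ is the sheaf of rational functions $\varphi$ with $\varphi=0$ or $\mathrm{div}(\varphi)+E\ge 0$. For a $\mathbb{Q}$-divisor $\Delta$ on $X$, $(X,\Delta)$ is *globally $+$-regular* if $\Delta\ge 0$ and for every finite dominant morphism $g:S\to X$ with $S$ normal and integral, the natural map $\mathcal{O}_X\to g_*\mathcal{O}_S(\lfloor g^*\Delta\rfloor)$ splits as a map of $\mathcal{O}_X$-modules. The pair $(X,\Delta)$ is *strongly globally $+$-regular* if for every effective Weil divisor $D\ge 0$ on $X$ there is a rational number $\epsilon>0$ such that $(X,\Delta+\epsilon D)$ is globally $+$-regular. A birational map $f:X\dashrightarrow Y$ is *small* if it restricts to an isomorphism between open subschemes $U\subseteq X$ and $V\subseteq Y$ whose complements have codimension at least two; then $f_*\Delta$ is the $\mathbb{Q}$-divisor on $Y$ that restricts on $V$ to the divisor corresponding to $\Delta|_U$ under $U\cong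 V$ and has no component contained in $Y\setminus V$. **Proposition.** Let $X$ and $Y$ be normal integral locally Noetherian schemes, and assume that $X$ is a Nagata scheme (for example, that $X$ is excellent). Let $\Delta$ be a $\mathbb{Q}$-divisor on $X$ such that $(X,\Delta)$ is strongly globally $+$-regular, and let $f:X\dashrightarrow Y$ be a small birational map. Then $(Y,f_*\Delta)$ is strongly globally $+$-regular. -/

import Mathlib

open CategoryTheory AlgebraicGeometry TopologicalSpace Order

universe u

noncomputable section

namespace PlusRegular

/-! ### Normal schemes and Nagata schemes -/

/-- A scheme is normal if all its local rings are integrally closed domains. -/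
class IsNormalScheme (X : Scheme.{u}) : Prop where
  isDomain_stalk (x : X) : IsDomain (X.presheaf.stalk x)
  isIntegrallyClosed_stalk (x : X) : IsIntegrallyClosed (X.presheaf.stalk x)

/-- A domain `R` is *N-2* (or *Japanese*) if its integral closure in every finite extension of its
field of fractions is a finite `R`-module. -/
def IsN2 (R : Type u) [CommRing R] [IsDomain R] : Prop :=
  ∀ (L : Type u) [Field L] [Algebra R L] [Algebra (FractionRing R) L]
    [IsScalarTower R (FractionRing R) L], Module.Finite (FractionRing R) L →
      Module.Finite R (integralClosure R L)

/-- A ring `R` is *Nagata* if it is Noetherian and `R ⧸ p` is N-2 for every prime ideal `p`. -/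
def IsNagataRing (R : Type u) [CommRing R] : Prop :=
  IsNoetherianRing R ∧ ∀ (p : Ideal R) [p.IsPrime], IsN2 (R ⧸ p)

/-- A scheme is *Nagata* if every point has an affine open neighbourhood whose ring of functions
is a Nagata ring. -/
class IsNagataScheme (X : Scheme.{u}) : Prop where
  exists_isNagataRing (x : X) : ∃ U : X.Opens, x ∈ U ∧ IsAffineOpen U ∧ IsNagataRing Γ(X, U)

/-! ### Weil divisors -/

/-- Weil divisors on `X` with coefficients in `R`: locally finite `R`-linear combinations of points
of codimension one (equivalently, of the prime divisors that are the closures of these points). -/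
def WeilDivisor (X : Scheme.{u}) (R : Type*) [AddCommGroup R] :
    AddSubgroup (AlgebraicCycle X R) where
  carrier := {D | ∀ x, D x ≠ 0 → coheight x = 1}
  zero_mem' x hx := (hx rfl).elim
  add_mem' {D E} hD hE x hx := by
    by_contra h
    exact hx (by
      rw [Function.locallyFinsuppWithin.coe_add, Pi.add_apply, not_not.1 (mt (hD x) h),
        not_not.1 (mt (hE x) h), add_zero])
  neg_mem' {D} hD x hx := hD x fun h ↦ hx (by
    rw [Function.locallyFinsuppWithin.coe_neg, Pi.neg_apply, h, neg_zero])

namespace WeilDivisor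

variable {X Y : Scheme.{u}}

/-- Apply a map `φ` with `φ 0 = 0` to all coefficients of a divisor. -/
def mapCoeff {R S : Type*} [AddCommGroup R] [AddCommGroup S] (φ : R → S) (hφ : φ 0 = 0)
    (D : WeilDivisor X R) : WeilDivisor X S where
  val :=
    { toFun x := φ (D.1 x)
      supportWithinDomain' := fun _ _ ↦ trivial
      supportLocallyFiniteWithinDomain' := fun z hz ↦ by
        obtain ⟨t, ht, h⟩ := D.1.supportLocallyFiniteWithinDomain z hz
        exact ⟨t, ht, h.subset fun x hx ↦ ⟨hx.1, fun h0 ↦ hx.2 (by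
          change φ (D.1 x) = 0
          rw [h0, hφ])⟩⟩ }
  property x hx := D.2 x fun h0 ↦ hx (by
    change φ (D.1 x) = 0
    rw [h0, hφ])

/-- The round-down `⌊D⌋` of a `ℚ`-divisor. -/
def floor (D : WeilDivisor X ℚ) : WeilDivisor X ℤ :=
  mapCoeff Int.floor Int.floor_zero D

/-- The `ℚ`-divisor `ε D` for a rational number `ε` and an integral divisor `D`. -/
def ratSMul (ε : ℚ) (D : WeilDivisor X ℤ) : WeilDivisor X ℚ :=
  mapCoeff (fun n : ℤ ↦ ε * n) (by simp) D

/-- The ramification index of `f : Y ⟶ X` at `y`: the length of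
`𝒪_{Y,y} / 𝔪_{f(y)} 𝒪_{Y,y}`. When the local rings at `y` and `f y` are discrete valuation rings
this is the order of vanishing at `y` of the pullback of a uniformizer at `f y`. -/
def ramificationIndex (f : Y ⟶ X) (y : Y) : ℕ :=
  (Module.length (Y.presheaf.stalk y) (Y.presheaf.stalk y ⧸
    (IsLocalRing.maximalIdeal (X.presheaf.stalk (f y))).map (f.stalkMap y).hom)).toNat

open Classical in
/-- The pullback `f^* D` of a `ℚ`-divisor along a finite morphism: its coefficient at a point `y` of
codimension one is the ramification index of `f` at `y` times the coefficient of `D` at `f y`. -/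
def pullback (f : Y ⟶ X) [IsFinite f] (D : WeilDivisor X ℚ) : WeilDivisor Y ℚ where
  val :=
    { toFun y := if coheight y = 1 then (ramificationIndex f y : ℚ) * D.1 (f y) else 0
      supportWithinDomain' := fun _ _ ↦ trivial
      supportLocallyFiniteWithinDomain' := fun z _ ↦ by
        obtain ⟨t, ht, h⟩ := D.1.supportLocallyFiniteWithinDomain (f z) trivial
        refine ⟨f ⁻¹' t, f.continuous.continuousAt.preimage_mem_nhds ht,
          (h.preimage' fun x _ ↦ f.finite_preimage_singleton x).subset fun y hy ↦ ⟨hy.1, ?_⟩⟩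
        intro h0
        have := hy.2
        simp_all }
  property y hy := by
    by_contra h
    exact hy (if_neg h)

open Classical in
/-- The pushforward `f_* D` of a `ℚ`-divisor along a birational map `f`, given as an isomorphism
from a dense open subscheme of `X` to a dense open subscheme of `Y`: the image of the prime
components of `D` that meet the source of `f`, with the same coefficients. -/
def pushforward [IsLocallyNoetherian Y] (f : X.PartialIso Y) (D : WeilDivisor X ℚ) :
    WeilDivisor Y ℚ where
  val :=
    { toFun y := if h : y ∈ f.target then D.1 ((f.iso.inv ≫ f.source.ι) ⟨y, h⟩) else 0
      supportWithinDomain' := fun _ _ ↦ trivial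
      supportLocallyFiniteWithinDomain' := fun z _ ↦ by
        obtain ⟨_, ⟨U, hU, rfl⟩, hz, -⟩ :=
          Y.isBasis_affineOpens.exists_subset_of_mem_open (Set.mem_univ z) isOpen_univ
        have : IsNoetherianRing Γ(Y, U) := IsLocallyNoetherian.component_noetherian ⟨U, hU⟩
        have hN : NoetherianSpace (U : Set Y) := noetherianSpace_of_isAffineOpen U hU
        have hK : IsCompact ((U : Set Y) ∩ f.target) := by
          have := (NoetherianSpace.isCompact ((Subtype.val : ↥(U : Set Y) → Y) ⁻¹' (f.target : Set Y))).image
            continuous_subtype_val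
          rwa [Subtype.image_preimage_coe] at this
        have hK' : IsCompact ((Subtype.val : f.target → Y) ⁻¹' (U : Set Y)) := by
          rw [Subtype.isCompact_iff]
          refine Eq.mp (congrArg IsCompact ?_) hK
          ext y
          exact ⟨fun h ↦ ⟨⟨y, h.2⟩, h.1, rfl⟩, by rintro ⟨y, h, rfl⟩; exact ⟨h, y.2⟩⟩
        have hfin := D.1.locallyFiniteSupport.finite_inter_support_of_isCompact
          (hK'.image (f.iso.inv ≫ f.source.ι).continuous)
        refine ⟨U, U.isOpen.mem_nhds hz, ((hfin.preimage
          (f.iso.inv ≫ f.source.ι).isOpenEmbedding.injective.injOn).image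
            (Subtype.val : f.target → Y)).subset ?_⟩
        rintro y ⟨hyU, hy⟩
        by_cases h : y ∈ f.target
        · refine ⟨⟨y, h⟩, ⟨⟨⟨y, h⟩, hyU, rfl⟩, ?_⟩, rfl⟩
          rwa [Function.mem_support, dif_pos h] at hy
        · exact (hy (dif_neg h)).elim }
  property y hy := by
    by_cases h : y ∈ f.target
    · have h1 : D.1 ((f.iso.inv ≫ f.source.ι) ⟨y, h⟩) ≠ 0 := fun h0 ↦ hy (by
        simp only [Function.locallyFinsuppWithin.coe_mk]
        rw [dif_pos h, h0])
      have h2 := D.2 _ h1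
      have h3 := coheight_eq_of_isOpenImmersion (U := f.target.toScheme) (x := ⟨y, h⟩)
        (f.iso.inv ≫ f.source.ι)
      have h4 := coheight_eq_of_isOpenImmersion (U := f.target.toScheme) (x := ⟨y, h⟩)
        f.target.ι
      exact h4.trans (h3.symm.trans h2)
    · exact (hy (dif_neg h)).elim

end WeilDivisor

/-! ### The sheaf `𝒪_X(E)` of a Weil divisor -/

/-- The structure sheaf `𝒪_X` as a module over itself. -/
abbrev structureModule (X : Scheme.{u}) : X.Modules := SheafOfModules.unit X.ringCatSheaf

section DivisorialSheaf

variable {X : Scheme.{u}} [IsIntegral X]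

/-- The ring homomorphism sending a function on `U` to the corresponding constant function
`U → K(X)`. -/
def toConst (U : X.Opens) : Γ(X, U) →+* (U → X.functionField) :=
  RingHom.pi fun x ↦
    (algebraMap (X.presheaf.stalk x.1) X.functionField).comp (X.presheaf.germ U x.1 x.2).hom

theorem toConst_apply (U : X.Opens) [Nonempty U] (r : Γ(X, U)) (x : U) :
    toConst U r x = algebraMap Γ(X, U) X.functionField r :=
  Scheme.algebraMap_germ_eq_germToFunctionField X x.2 r

theorem toConst_map {U V : (Opens X)ᵒᵖ} (i : U ⟶ V) (r : Γ(X, U.unop)) (x : V.unop) :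
    toConst V.unop (X.presheaf.map i r) x = toConst U.unop r (i.unop x) := by
  simp only [toConst, RingHom.pi_apply, RingHom.comp_apply]
  congr 1
  exact X.presheaf.germ_res_apply i.unop x.1 x.2 r

variable [IsLocallyNoetherian X]

theorem ord_one (x : X) : Scheme.ord (1 : X.functionField) x = 0 := by
  have := Scheme.ord_mul (x := x) (one_ne_zero (α := X.functionField)) one_ne_zero
  rw [mul_one] at this
  omega

/-- The sections of `𝒪_X(E)` over `U`: rational functions `φ` with `φ = 0` or
`ord_x(φ) + E(x) ≥ 0` for every point `x ∈ U` of codimension one. They form a subsheaf of the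
constant sheaf `K(X)`, whose sections over `U` are the locally constant functions `U → K(X)`
(these are constant, unless `U` is empty). -/
def divisorPredicate (E : WeilDivisor X ℤ) :
    TopCat.LocalPredicate (X := X.toTopCat) fun _ ↦ X.functionField where
  pred {U} s := IsLocallyConstant s ∧
    ∀ x : U, coheight (α := X) x.1 = 1 → s x = 0 ∨ 0 ≤ Scheme.ord (s x) x.1 + E.1 x.1
  res {U V} i s hs := ⟨hs.1.comp_continuous (Opens.isOpenEmbedding_of_le i.le).continuous,
    fun x ↦ hs.2 (i x)⟩
  locality {U} s hs := by
    constructor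
    · rw [IsLocallyConstant.iff_exists_open]
      intro x
      obtain ⟨V, hxV, i, h, -⟩ := hs x
      obtain ⟨W, hW, hxW, h'⟩ := (IsLocallyConstant.iff_exists_open _).1 h ⟨x.1, hxV⟩
      refine ⟨i '' W, (Opens.isOpenEmbedding_of_le i.le).isOpenMap _ hW, ⟨_, hxW, rfl⟩, ?_⟩
      rintro _ ⟨y, hy, rfl⟩
      exact h' y hy
    · intro x hx
      obtain ⟨V, hxV, i, -, h⟩ := hs x
      exact h ⟨x.1, hxV⟩ hx

variable [IsNormalScheme X]

theorem isDiscreteValuationRing_stalk (x : X) (hx : coheight x = 1) :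
    IsDiscreteValuationRing (X.presheaf.stalk x) := by
  have h1 : ringKrullDim (X.presheaf.stalk x) = 1 := by
    rw [ringKrullDim_stalk_eq_coheight, hx]; rfl
  have hf : ¬ IsField (X.presheaf.stalk x) := fun h ↦ by
    have := ringKrullDim_eq_zero_of_isField h
    rw [h1] at this
    exact one_ne_zero this
  have : IsIntegrallyClosed (X.presheaf.stalk x) := IsNormalScheme.isIntegrallyClosed_stalk x
  have : Ring.DimensionLEOne (X.presheaf.stalk x) := by
    have := krullDimLE_of_coheight_le hx.le
    exact ⟨fun h0 hp ↦ Ring.krullDimLE_one_iff_of_noZeroDivisors.1 this _ h0 hp⟩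
  have : IsDedekindDomain (X.presheaf.stalk x) := { }
  exact ((IsDiscreteValuationRing.TFAE (X.presheaf.stalk x) hf).out 0 2).2 this

/-- The group of sections of `𝒪_X(E)` over `U`. -/
def divisorSections (E : WeilDivisor X ℤ) (U : X.Opens) : AddSubgroup (U → X.functionField) where
  carrier := {s | (divisorPredicate E).pred s}
  zero_mem' := ⟨IsLocallyConstant.const 0, fun _ _ ↦ Or.inl rfl⟩
  add_mem' {s t} hs ht := by
    refine ⟨hs.1.add ht.1, fun x hx ↦ ?_⟩
    have := isDiscreteValuationRing_stalk x.1 hx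
    rcases hs.2 x hx with h | h
    · simpa [h] using ht.2 x hx
    rcases ht.2 x hx with h' | h'
    · simpa [h'] using Or.inr h
    by_cases h0 : s x + t x = 0
    · exact Or.inl h0
    · have := Scheme.ord_add (x := x.1) h0
      right
      simp only [Pi.add_apply]
      omega
  neg_mem' {s} hs := by
    refine ⟨hs.1.neg, fun x hx ↦ ?_⟩
    rcases hs.2 x hx with h | h
    · left; simp [h]
    by_cases h0 : s x = 0
    · left; simp [h0]
    right
    have h1 : Scheme.ord (-1 : X.functionField) x.1 = 0 := by
      have := Scheme.ord_mul (x := x.1) (neg_ne_zero.2 (one_ne_zero (α := X.functionField)))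
        (neg_ne_zero.2 (one_ne_zero (α := X.functionField)))
      rw [neg_mul_neg, mul_one, ord_one] at this
      omega
    have h2 := Scheme.ord_mul (x := x.1) (neg_ne_zero.2 (one_ne_zero (α := X.functionField))) h0
    rw [neg_one_mul, h1, zero_add] at h2
    rw [Pi.neg_apply, h2]
    exact h

/-- `𝒪_X(E)(U)` is closed under multiplication by functions on `U`. -/
theorem toConst_mul_mem (E : WeilDivisor X ℤ) (U : X.Opens) (r : Γ(X, U))
    {s : U → X.functionField} (hs : s ∈ divisorSections E U) :
    toConst U r * s ∈ divisorSections E U := by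
  have hc : IsLocallyConstant (toConst U r) := by
    rcases isEmpty_or_nonempty U with h | h
    · exact IsLocallyConstant.of_constant _ fun x ↦ h.elim x
    · exact IsLocallyConstant.of_constant _ fun x y ↦ by rw [toConst_apply, toConst_apply]
  refine ⟨hc.mul hs.1, fun x hx ↦ ?_⟩
  have : Nonempty U := ⟨x⟩
  rcases hs.2 x hx with h | h
  · left; simp [h]
  by_cases hr : r = 0
  · left; simp [hr]
  right
  have := Scheme.ord_le_smul x.2 hr (s x)
  rw [Algebra.smul_def, ← toConst_apply U r x] at this
  exact h.trans (by simpa using this)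

/-- Functions on `U` act on `𝒪_X(E)(U)` by multiplication in `K(X)`. -/
instance (E : WeilDivisor X ℤ) (U : X.Opens) : Module Γ(X, U) (divisorSections E U) where
  smul r s := ⟨toConst U r * s.1, toConst_mul_mem E U r s.2⟩
  one_smul s := Subtype.ext (by change toConst U 1 * s.1 = s.1; rw [map_one, one_mul])
  mul_smul a b s := Subtype.ext (by
    change toConst U (a * b) * s.1 = toConst U a * (toConst U b * s.1)
    rw [map_mul, mul_assoc])
  smul_zero a := Subtype.ext (mul_zero _)
  smul_add a s t := Subtype.ext (mul_add _ _ _)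
  add_smul a b s := Subtype.ext (by
    change toConst U (a + b) * s.1 = toConst U a * s.1 + toConst U b * s.1
    rw [map_add, add_mul])
  zero_smul s := Subtype.ext (by change toConst U 0 * s.1 = 0; rw [map_zero, zero_mul])

/-- The presheaf of abelian groups underlying `𝒪_X(E)`, with the restriction of functions. -/
def divisorPresheaf (E : WeilDivisor X ℤ) : TopCat.Presheaf Ab.{u} X.toTopCat where
  obj U := AddCommGrpCat.of (divisorSections E U.unop)
  map i := AddCommGrpCat.ofHom
    { toFun s := ⟨fun x ↦ s.1 (i.unop x), (divisorPredicate E).res i.unop s.1 s.2⟩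
      map_zero' := rfl
      map_add' _ _ := rfl }

instance (E : WeilDivisor X ℤ) (U : (Opens X)ᵒᵖ) :
    Module (X.ringCatSheaf.obj.obj U) ((divisorPresheaf E).obj U) :=
  inferInstanceAs (Module Γ(X, U.unop) (divisorSections E U.unop))

/-- The sheaf of `𝒪_X`-modules `𝒪_X(E)` of a Weil divisor `E` on a normal scheme. -/
def divisorSheaf (E : WeilDivisor X ℤ) : X.Modules where
  val := .ofPresheaf (R := X.ringCatSheaf.obj) (divisorPresheaf E) fun U V i r s ↦ by
    apply Subtype.ext
    funext x
    exact congrArg (· * s.1 (i.unop x)) (toConst_map i r x).symm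
  isSheaf := (TopCat.Presheaf.isSheaf_iff_isSheaf_comp (forget Ab) _).2
    (TopCat.subsheafToTypes (divisorPredicate E)).2

/-- For effective `E`, the section `1` of `𝒪_X(E)`. -/
def oneSection (E : WeilDivisor X ℤ) (hE : 0 ≤ E) : (divisorSheaf E).val.sections :=
  PresheafOfModules.sectionsMk (M := (divisorSheaf E).val)
    (fun U ↦ (⟨fun _ ↦ 1, IsLocallyConstant.const 1, fun x _ ↦ Or.inr (by
      rw [ord_one, zero_add]
      exact hE x.1)⟩ : divisorSections E U.unop)) fun _ _ _ ↦ rfl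

/-- For effective `E`, the inclusion `𝒪_X ⟶ 𝒪_X(E)`, which sends `1` to `1`. -/
def structureModuleToDivisorSheaf (E : WeilDivisor X ℤ) (hE : 0 ≤ E) :
    structureModule X ⟶ divisorSheaf E :=
  (SheafOfModules.unitHomEquiv (divisorSheaf E)).symm (oneSection E hE)

end DivisorialSheaf

/-! ### Globally `+`-regular pairs -/

theorem WeilDivisor.floor_pullback_nonneg {X Y : Scheme.{u}} (f : Y ⟶ X) [IsFinite f]
    {Δ : WeilDivisor X ℚ} (hΔ : 0 ≤ Δ) : 0 ≤ WeilDivisor.floor (WeilDivisor.pullback f Δ) := by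
  intro y
  change (0 : ℤ) ≤ ⌊if coheight y = 1 then (ramificationIndex f y : ℚ) * Δ.1 (f y) else 0⌋
  rw [Int.floor_nonneg]
  split_ifs
  · exact mul_nonneg (Nat.cast_nonneg _) (hΔ (f y))
  · exact le_rfl

/-- The natural map `𝒪_X ⟶ f_* 𝒪_Y ⟶ f_* 𝒪_Y(⌊f^* Δ⌋)` for an effective `ℚ`-divisor `Δ` on `X`
and a finite morphism `f : Y ⟶ X` from a normal integral scheme. -/
def plusMap {X Y : Scheme.{u}} [IsIntegral Y] [IsLocallyNoetherian Y] [IsNormalScheme Y]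
    (f : Y ⟶ X) [IsFinite f] (Δ : WeilDivisor X ℚ) (hΔ : 0 ≤ Δ) :
    structureModule X ⟶ (Scheme.Modules.pushforward f).obj
      (divisorSheaf (WeilDivisor.floor (WeilDivisor.pullback f Δ))) :=
  SheafOfModules.unitToPushforwardObjUnit f.toRingCatSheafHom ≫
    (Scheme.Modules.pushforward f).map
      (structureModuleToDivisorSheaf _ (WeilDivisor.floor_pullback_nonneg f hΔ))

/-- `(X, Δ)` is *globally `+`-regular*: `Δ` is effective, and for every finite dominant morphism
`f : Y ⟶ X` from a normal integral scheme, `𝒪_X ⟶ f_* 𝒪_Y(⌊f^* Δ⌋)` splits as a map of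
`𝒪_X`-modules. (`Y` is automatically locally Noetherian when `X` is.) -/
def IsGloballyPlusRegular (X : Scheme.{u}) (Δ : WeilDivisor X ℚ) : Prop :=
  ∃ hΔ : 0 ≤ Δ, ∀ (Y : Scheme.{u}) [IsIntegral Y] [IsLocallyNoetherian Y] [IsNormalScheme Y]
    (f : Y ⟶ X) [IsFinite f] [IsDominant f], IsSplitMono (plusMap f Δ hΔ)

/-- `(X, Δ)` is *strongly globally `+`-regular*: for every effective (integral) Weil divisor `D`
there is a rational `ε > 0` such that `(X, Δ + ε D)` is globally `+`-regular. -/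
def IsStronglyGloballyPlusRegular (X : Scheme.{u}) (Δ : WeilDivisor X ℚ) : Prop :=
  ∀ D : WeilDivisor X ℤ, 0 ≤ D →
    ∃ ε : ℚ, 0 < ε ∧ IsGloballyPlusRegular X (Δ + WeilDivisor.ratSMul ε D)

/-- A birational map, given as an isomorphism between dense open subschemes of `X` and `Y`, is
*small* if the complements of these open subschemes have codimension at least two. -/
def IsSmall {X Y : Scheme.{u}} (f : X.PartialIso Y) : Prop :=
  (∀ x : X, x ∉ f.source → 2 ≤ coheight x) ∧ ∀ y : Y, y ∉ f.target → 2 ≤ coheight y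

end PlusRegular

end

/-!
Let `Z` be the open subscheme of both `X` and `Y` on which `f` is an isomorphism. A finite cover
`T → Y` restricts to a finite cover `Q → Z`, and the normalization `S` of `X` in `Q` is finite over
`X` because `X` is Nagata. By Zariski's main theorem `Q` is open in `S`, and it is the whole
preimage of `Z` because it is finite over `Z`.

A splitting over `X` is a `K(X)`-linear map `K(S) → K(X)` sending `1` to `1` and sections of the
divisorial sheaf to regular functions; by Hartogs' lemma regularity is a condition at points of
codimension one. The function fields over `X`, `Z` and `Y` agree and `Z` contains the points of `Y`
of codimension one, so a splitting for `S → X` restricts to one for `Q → Z` and extends to one for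
`T → Y`. The boundary `ε D` on `Y` is dealt with by the boundary `ε D'` on `X`, where `D'` is the
strict transform of `D`.
-/

noncomputable section

namespace PlusRegular

section CommutativeAlgebra

variable {A B K : Type*} [CommRing A] [Field K] [Algebra A K]

theorem exists_smul_notMem_map_of_not_isIntegral {I : Ideal A} (hI : I.FG)
    (hI0 : I.map (algebraMap A K) ≠ ⊥) {y : K} (hy : ¬ IsIntegral A y) :
    ∃ t ∈ I, t • y ∉ Submodule.map (Algebra.linearMap A K) I := by
  by_contra! hstable
  refine hy (isIntegral_of_smul_mem_submodule _ (fun hbot ↦ hI0 ?_)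
    (Submodule.FG.map (Algebra.linearMap A K) hI) y ?_)
  · rw [Ideal.map_eq_bot_iff_le_ker]
    exact fun a ha ↦ (Submodule.mem_bot A).1 (hbot ▸ Submodule.mem_map_of_mem ha)
  · rintro _ ⟨t, ht, rfl⟩
    have hty : y • algebraMap A K t = t • y := by rw [smul_eq_mul, mul_comm, Algebra.smul_def]
    exact hty ▸ hstable t ht

theorem height_eq_one_of_isAssociatedPrime_quotient_one [IsDomain A] [IsNoetherianRing A]
    [IsIntegrallyClosed A] [IsFractionRing A K] {p : Ideal A}
    (hp : IsAssociatedPrime p (K ⧸ (1 : Submodule A K))) : p.height = 1 := by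
  obtain ⟨hprime, ybar, hpy⟩ := isAssociatedPrime_iff.1 hp
  obtain ⟨y, rfl⟩ := Submodule.Quotient.mk_surjective _ ybar
  replace hpy (a : A) : a ∈ p ↔ ∃ c, algebraMap A K c = a • y := by
    rw [hpy, Submodule.mem_colon_singleton, Submodule.mem_bot, ← Submodule.Quotient.mk_smul,
      Submodule.Quotient.mk_eq_zero, Submodule.mem_one]
  have hy : ¬ IsIntegral A y := fun h ↦ hprime.ne_top <| (Ideal.eq_top_iff_one p).2 <|
    (hpy 1).2 <| (one_smul A y).symm ▸ IsIntegrallyClosed.isIntegral_iff.1 h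
  have hp0 : p ≠ ⊥ := by
    obtain ⟨⟨a, s⟩, has⟩ := IsLocalization.surj (nonZeroDivisors A) y
    refine fun h ↦ nonZeroDivisors.ne_zero s.2 ?_
    rw [← Ideal.mem_bot, ← h, hpy]
    exact ⟨a, by rw [← has, mul_comm, Algebra.smul_def]⟩
  obtain ⟨t, ht, hty⟩ := exists_smul_notMem_map_of_not_isIntegral (IsNoetherian.noetherian p)
    (fun h ↦ hp0 ((Ideal.map_eq_bot_iff_of_injective (IsFractionRing.injective A K)).1 h)) hy
  obtain ⟨w, hw⟩ := (hpy t).1 ht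
  have hwp : w ∉ p := fun h ↦ hty ⟨w, h, hw⟩
  -- As `t y = w` is a unit at `p`, the ideal `p = {a | a y ∈ A}` is generated by `t` at `p`.
  have hmin : p ∈ (Ideal.span {t}).minimalPrimes := by
    refine ⟨⟨hprime, (Ideal.span_singleton_le_iff_mem p).2 ht⟩, fun q ⟨hq, htq⟩ hqp a ha ↦ ?_⟩
    obtain ⟨c, hc⟩ := (hpy a).1 ha
    have haw : a * w = t * c := IsFractionRing.injective A K (by
      rw [map_mul, map_mul, hw, hc, Algebra.smul_def, Algebra.smul_def]; ring)
    refine (hq.mem_or_mem (haw ▸ ?_ : a * w ∈ q)).resolve_right fun h ↦ hwp (hqp h)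
    exact q.mul_mem_right c ((Ideal.span_singleton_le_iff_mem q).1 htq)
  refine le_antisymm (Ideal.height_le_one_of_isPrincipal_of_mem_minimalPrimes _ _ hmin) ?_
  exact one_le_iff_ne_zero.2 fun h ↦ hp0 (Ideal.height_eq_zero_iff_eq_bot.1 h)

theorem mem_one_of_forall_height_eq_one [IsDomain A] [IsNoetherianRing A]
    [IsIntegrallyClosed A] [IsFractionRing A K] (x : K)
    (h : ∀ p : Ideal A, p.IsPrime → p.height = 1 → ∃ s ∉ p, s • x ∈ (1 : Submodule A K)) :
    x ∈ (1 : Submodule A K) := by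
  by_contra hx
  obtain ⟨p, hp, hle⟩ := exists_le_isAssociatedPrime_of_isNoetherianRing A
    (Submodule.Quotient.mk x : K ⧸ (1 : Submodule A K))
    fun h0 ↦ hx ((Submodule.Quotient.mk_eq_zero _).1 h0)
  obtain ⟨s, hsp, hs⟩ :=
    h p hp.isPrime (height_eq_one_of_isAssociatedPrime_quotient_one hp)
  refine hsp (hle ?_)
  rw [Submodule.mem_colon_singleton, Submodule.mem_bot, ← Submodule.Quotient.mk_smul,
    Submodule.Quotient.mk_eq_zero]
  exact hs

theorem exists_notMem_smul_mem_one_of_mem_range [CommRing B] [Algebra A B] [Algebra B K]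
    [IsScalarTower A B K] (p : Ideal A) [p.IsPrime] [IsLocalization.AtPrime B p] {x : K}
    (hx : x ∈ (algebraMap B K).range) : ∃ s ∉ p, s • x ∈ (1 : Submodule A K) := by
  obtain ⟨b, rfl⟩ := hx
  obtain ⟨⟨a, s⟩, has⟩ := IsLocalization.surj p.primeCompl b
  refine ⟨s, s.2, Submodule.mem_one.2 ⟨a, ?_⟩⟩
  rw [IsScalarTower.algebraMap_apply A B K, ← has, map_mul, mul_comm, Algebra.smul_def,
    IsScalarTower.algebraMap_apply A B K]

theorem finite_integralClosure_of_injective {L C : Type*} [IsNoetherianRing A] [CommRing L]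
    [Algebra A L] [CommRing C] [Algebra A C] [Module.Finite A (integralClosure A L)]
    (k : C →ₐ[A] L) (hk : Function.Injective k) : Module.Finite A (integralClosure A C) :=
  Module.Finite.of_injective k.mapIntegralClosure.toLinearMap fun _ _ hxy ↦
    Subtype.ext (hk (congrArg Subtype.val hxy))

theorem IsNagataRing.finite_integralClosure {A : Type u} [CommRing A] [IsDomain A]
    (hA : IsNagataRing A) (K L : Type u) [Field K] [Algebra A K] [IsFractionRing A K] [Field L]
    [Algebra K L] [Algebra A L] [IsScalarTower A K L] [Module.Finite K L] :
    Module.Finite A (integralClosure A L) := by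
  let R := A ⧸ (⊥ : Ideal A)
  let e : R ≃+* A := RingEquiv.quotientBot A
  let : Algebra R K := ((algebraMap A K).comp (e : R →+* A)).toAlgebra
  have : IsFractionRing R K :=
    (IsFractionRing.isFractionRing_iff_of_base_ringEquiv K e.symm).1 inferInstance
  let eF : FractionRing R ≃ₐ[R] K := FractionRing.algEquiv R K
  let : Algebra R L := ((algebraMap K L).comp (algebraMap R K)).toAlgebra
  let : Algebra (FractionRing R) L := ((algebraMap K L).comp (eF : FractionRing R →+* K)).toAlgebra
  have : IsScalarTower R (FractionRing R) L := .of_algebraMap_eq fun x ↦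
    (congrArg (algebraMap K L) (eF.commutes x)).symm
  have hfin : Module.Finite (FractionRing R) L := by
    refine RingHom.finite_algebraMap.1 (RingHom.Finite.comp ?_
      (RingHom.Finite.of_surjective (eF : FractionRing R →+* K) eF.surjective))
    exact RingHom.finite_algebraMap.2 inferInstance
  have : Module.Finite R (integralClosure R L) := hA.2 ⊥ L hfin
  have : IsScalarTower A R L :=
    .of_algebraMap_eq fun x ↦ IsScalarTower.algebraMap_apply A K L x
  have : Module.Finite A (integralClosure R L) := .trans R _
  have := hA.1
  let toClosure : integralClosure A L →ₗ[A] integralClosure R L :=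
    { toFun x := ⟨x, x.2.tower_top⟩
      map_add' _ _ := rfl
      map_smul' _ _ := rfl }
  exact Module.Finite.of_injective toClosure fun _ _ hxy ↦
    Subtype.ext (Subtype.ext_iff.1 hxy :)

theorem length_quotient_map_ringEquiv {R S : Type*} [CommRing R] [CommRing S] (e : R ≃+* S)
    (I : Ideal R) :
    Module.length S (S ⧸ I.map (e : R →+* S)) = Module.length R (R ⧸ I) := by
  algebraize [(e : R →+* S)]
  rw [← Module.length_eq_of_surjective (R := S) (S := R) (M := S ⧸ I.map (e : R →+* S))
    e.surjective]
  let f : R ≃ₐ[R] S := AlgEquiv.ofRingEquiv (f := e) fun _ ↦ rfl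
  exact (Ideal.quotientEquivAlg I (I.map (e : R →+* S)) f rfl).toLinearEquiv.length_eq.symm

theorem ringOrd_ringEquiv {R S : Type*} [CommRing R] [CommRing S] (e : R ≃+* S) (r : R) :
    Ring.ord S (e r) = Ring.ord R r := by
  rw [Ring.ord, Ring.ord, ← length_quotient_map_ringEquiv e, Ideal.map_span,
    RingEquiv.coe_toRingHom, Set.image_singleton]

theorem ordMonoidWithZeroHom_ringEquiv {R S : Type*} [CommRing R] [IsDomain R] [CommRing S]
    [IsDomain S] (e : R ≃+* S) (r : R) :
    Ring.ordMonoidWithZeroHom S (e r) = Ring.ordMonoidWithZeroHom R r := by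
  rcases eq_or_ne r 0 with rfl | hr
  · rw [map_zero, map_zero, map_zero]
  rw [Ring.ordMonoidWithZeroHom_eq_ord (mem_nonZeroDivisors_of_ne_zero hr),
    Ring.ordMonoidWithZeroHom_eq_ord
      (mem_nonZeroDivisors_of_ne_zero ((map_ne_zero_iff e e.injective).2 hr)),
    ringOrd_ringEquiv]

theorem ordFrac_map_ringEquiv {R S : Type*} [CommRing R] [IsNoetherianRing R]
    [Ring.KrullDimLE 1 R] [IsDomain R] [CommRing S] [IsNoetherianRing S] [Ring.KrullDimLE 1 S]
    [IsDomain S] {K L : Type*} [Field K] [Field L] [Algebra R K] [IsFractionRing R K]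
    [Algebra S L] [IsFractionRing S L] (e : R ≃+* S) (σ : K →+* L)
    (h : ∀ r, σ (algebraMap R K r) = algebraMap S L (e r)) (x : K) :
    Ring.ordFrac S (σ x) = Ring.ordFrac R x := by
  have hR {r : R} (hr : r ≠ 0) :
      Ring.ordFrac S (σ (algebraMap R K r)) = Ring.ordFrac R (algebraMap R K r) := by
    rw [h, Ring.ordFrac_eq_ord _ ((map_ne_zero_iff e e.injective).2 hr),
      Ring.ordFrac_eq_ord _ hr, ordMonoidWithZeroHom_ringEquiv]
  obtain ⟨a, b, hb, rfl⟩ := IsFractionRing.div_surjective (A := R) x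
  rcases eq_or_ne a 0 with rfl | ha
  · simp only [map_zero, zero_div]
  rw [map_div₀, map_div₀, map_div₀, hR ha, hR (nonZeroDivisors.ne_zero hb)]

end CommutativeAlgebra

section FunctionField

variable {X Y Z : Scheme.{u}} [IsIntegral X] [IsIntegral Y] [IsIntegral Z]

theorem genericPoint_mem (U : X.Opens) [hU : Nonempty U] : genericPoint X ∈ U :=
  ((genericPoint_spec X).mem_open_set_iff U.isOpen).2 (by simpa using hU)

theorem map_genericPoint (f : Y ⟶ X) [IsDominant f] : f (genericPoint Y) = genericPoint X := by
  refine ((genericPoint_spec Y).image f.continuous).eq ?_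
  rw [Set.image_univ, f.denseRange.closure_range]
  exact genericPoint_spec X

instance nonempty_preimage (f : Y ⟶ X) [IsDominant f] (U : X.Opens) [Nonempty U] :
    Nonempty (f ⁻¹ᵁ U) :=
  ⟨⟨genericPoint Y, show f (genericPoint Y) ∈ U from map_genericPoint f ▸ genericPoint_mem U⟩⟩

theorem isDominant_of_isOpenImmersion (f : Y ⟶ X) [IsOpenImmersion f] : IsDominant f :=
  ⟨f.isOpenEmbedding.isOpen_range.dense ⟨_, Set.mem_range_self (genericPoint Y)⟩⟩

/-- The extension of function fields induced by a dominant morphism of integral schemes. -/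
def functionFieldMap (f : Y ⟶ X) [IsDominant f] : X.functionField →+* Y.functionField :=
  (X.presheaf.stalkSpecializes (specializes_of_eq (map_genericPoint f)) ≫
    f.stalkMap (genericPoint Y)).hom

theorem functionFieldMap_algebraMap (f : Y ⟶ X) [IsDominant f] (y : Y)
    (s : X.presheaf.stalk (f y)) :
    functionFieldMap f (algebraMap _ _ s) =
      algebraMap (Y.presheaf.stalk y) Y.functionField (f.stalkMap y s) := by
  have h : X.presheaf.stalkSpecializes ((genericPoint_spec X).specializes (Set.mem_univ (f y))) ≫
      X.presheaf.stalkSpecializes (specializes_of_eq (map_genericPoint f)) ≫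
        f.stalkMap (genericPoint Y) =
      f.stalkMap y ≫
        Y.presheaf.stalkSpecializes ((genericPoint_spec Y).specializes (Set.mem_univ y)) := by
    rw [TopCat.Presheaf.stalkSpecializes_comp_assoc, ← Scheme.Hom.stalkSpecializes_stalkMap]
  exact congr($(h).hom s)

theorem functionFieldMap_toConst (f : Y ⟶ X) [IsDominant f] (U : X.Opens) (s : Γ(X, U))
    (y : f ⁻¹ᵁ U) :
    functionFieldMap f (toConst U s ⟨f y, y.2⟩) = toConst (f ⁻¹ᵁ U) (f.app U s) y :=
  (functionFieldMap_algebraMap f y.1 _).trans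
    (congrArg _ (f.germ_stalkMap_apply U y.1 y.2 s))

theorem functionFieldMap_comp (f : Y ⟶ X) (g : Z ⟶ Y) [IsDominant f] [IsDominant g]
    [IsDominant (g ≫ f)] (φ : X.functionField) :
    functionFieldMap (g ≫ f) φ = functionFieldMap g (functionFieldMap f φ) := by
  obtain ⟨a, b, -, rfl⟩ := IsFractionRing.div_surjective
    (A := X.presheaf.stalk (f (g (genericPoint Z)))) φ
  have h (s : X.presheaf.stalk (f (g (genericPoint Z)))) :
      functionFieldMap (g ≫ f) (algebraMap _ _ s) =
        functionFieldMap g (functionFieldMap f (algebraMap _ _ s)) := by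
    rw [functionFieldMap_algebraMap, functionFieldMap_algebraMap]
    refine (functionFieldMap_algebraMap (g ≫ f) (genericPoint Z) s).trans (congrArg _ ?_)
    exact congr($(Scheme.Hom.stalkMap_comp g f (genericPoint Z)).hom s)
  rw [map_div₀, map_div₀, map_div₀, h, h]

theorem functionFieldMap_congr {f g : Y ⟶ X} [IsDominant f] [IsDominant g] (h : f = g)
    (φ : X.functionField) : functionFieldMap f φ = functionFieldMap g φ := by
  subst h
  rfl

theorem functionFieldMap_comm {W : Scheme.{u}} [IsIntegral W] {j : W ⟶ Z} {h : Z ⟶ X} {q : W ⟶ Y}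
    {a : Y ⟶ X} [IsDominant j] [IsDominant h] [IsDominant q] [IsDominant a]
    (hcomm : j ≫ h = q ≫ a) (φ : X.functionField) :
    functionFieldMap j (functionFieldMap h φ) = functionFieldMap q (functionFieldMap a φ) := by
  rw [← functionFieldMap_comp, ← functionFieldMap_comp, functionFieldMap_congr hcomm]

theorem functionFieldMap_bijective (f : Y ⟶ X) [IsOpenImmersion f] [IsDominant f] :
    Function.Bijective (functionFieldMap f) := by
  have : IsIso (X.presheaf.stalkSpecializes (specializes_of_eq (map_genericPoint f))) :=
    (X.presheaf.stalkCongr (.of_eq (map_genericPoint f))).isIso_inv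
  exact ConcreteCategory.bijective_of_isIso (X.presheaf.stalkSpecializes
    (specializes_of_eq (map_genericPoint f)) ≫ f.stalkMap (genericPoint Y))

/-- The isomorphism of function fields induced by an open immersion of integral schemes. -/
def functionFieldEquiv (f : Y ⟶ X) [IsOpenImmersion f] [IsDominant f] :
    X.functionField ≃+* Y.functionField :=
  .ofBijective (functionFieldMap f) (functionFieldMap_bijective f)

theorem functionFieldEquiv_apply (f : Y ⟶ X) [IsOpenImmersion f] [IsDominant f]
    (φ : X.functionField) : functionFieldEquiv f φ = functionFieldMap f φ :=
  rfl

theorem functionFieldMap_mem_range_iff (f : Y ⟶ X) [IsOpenImmersion f] [IsDominant f] (y : Y)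
    (φ : X.functionField) :
    functionFieldMap f φ ∈ (algebraMap (Y.presheaf.stalk y) Y.functionField).range ↔
      φ ∈ (algebraMap (X.presheaf.stalk (f y)) X.functionField).range := by
  constructor
  · rintro ⟨s, hs⟩
    obtain ⟨t, rfl⟩ := (ConcreteCategory.bijective_of_isIso (f.stalkMap y)).2 s
    exact ⟨t, (functionFieldMap f).injective ((functionFieldMap_algebraMap f y t).trans hs)⟩
  · rintro ⟨t, rfl⟩
    exact ⟨_, (functionFieldMap_algebraMap f y t).symm⟩

theorem ord_functionFieldMap [IsLocallyNoetherian X] [IsLocallyNoetherian Y] (f : Y ⟶ X)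
    [IsOpenImmersion f] [IsDominant f] (φ : X.functionField) (y : Y) :
    Scheme.ord (functionFieldMap f φ) y = Scheme.ord φ (f y) := by
  have hcoheight : coheight (f y) = coheight y := coheight_eq_of_isOpenImmersion f
  by_cases hy : coheight y = 1
  · have hx : coheight (f y) = 1 := hcoheight.trans hy
    have := krullDimLE_of_coheight_le hy.le
    have := krullDimLE_of_coheight_le hx.le
    rw [Scheme.ord_eq_ordHom_of_coheight_eq_one hy, Scheme.ord_eq_ordHom_of_coheight_eq_one hx,
      Scheme.ordHom, Scheme.ordHom,
      ordFrac_map_ringEquiv (asIso (f.stalkMap y)).commRingCatIsoToRingEquiv]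
    exact functionFieldMap_algebraMap f y
  · rw [Scheme.ord_eq_zero_of_coheight_neq_one hy,
      Scheme.ord_eq_zero_of_coheight_neq_one (hcoheight ▸ hy)]

end FunctionField

section Ramification

variable {X Y Z : Scheme.{u}}

theorem ramificationIndex_comp_of_isOpenImmersion_left (j : Z ⟶ Y) [IsOpenImmersion j] (f : Y ⟶ X)
    (z : Z) : WeilDivisor.ramificationIndex (j ≫ f) z = WeilDivisor.ramificationIndex f (j z) := by
  rw [WeilDivisor.ramificationIndex, WeilDivisor.ramificationIndex,
    ← length_quotient_map_ringEquiv (asIso (j.stalkMap z)).commRingCatIsoToRingEquiv,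
    Ideal.map_map, Scheme.Hom.stalkMap_comp]
  rfl

theorem ramificationIndex_comp_of_isOpenImmersion_right (f : Z ⟶ Y) (j : Y ⟶ X)
    [IsOpenImmersion j] (z : Z) :
    WeilDivisor.ramificationIndex (f ≫ j) z = WeilDivisor.ramificationIndex f z := by
  have h : (IsLocalRing.maximalIdeal (X.presheaf.stalk (j (f z)))).map (j.stalkMap (f z)).hom =
      IsLocalRing.maximalIdeal (Y.presheaf.stalk (f z)) :=
    IsLocalRing.map_ringEquiv_maximalIdeal (asIso (j.stalkMap (f z))).commRingCatIsoToRingEquiv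
  rw [WeilDivisor.ramificationIndex, WeilDivisor.ramificationIndex, ← h, Ideal.map_map,
    Scheme.Hom.stalkMap_comp]
  rfl

end Ramification

section Hartogs

theorem coheight_fromSpec {X : Scheme.{u}} {U : X.Opens} (hU : IsAffineOpen U)
    (P : PrimeSpectrum Γ(X, U)) :
    coheight (hU.fromSpec P) = P.asIdeal.height :=
  (coheight_eq_of_isOpenImmersion hU.fromSpec).trans (idealHeight_eq_coheight Γ(X, U) P).symm

variable {X : Scheme.{u}} [IsIntegral X]

theorem toConst_eq (U : X.Opens) (s : Γ(X, U)) (y z : U) : toConst U s y = toConst U s z := by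
  have : Nonempty U := ⟨y⟩
  rw [toConst_apply, toConst_apply]

theorem toConst_injective (U : X.Opens) : Function.Injective (toConst U) := by
  refine fun s t h ↦ TopCat.Presheaf.section_ext X.sheaf U s t fun x hx ↦ ?_
  exact IsFractionRing.injective (X.presheaf.stalk x) X.functionField (congrFun h ⟨x, hx⟩)

theorem exists_toConst_eq_const (U : X.Opens) (φ : X.functionField)
    (h : ∀ y ∈ U, φ ∈ (algebraMap (X.presheaf.stalk y) X.functionField).range) :
    ∃ s : Γ(X, U), toConst U s = Function.const ↥U φ := by
  have hlocal (y : U) : ∃ (V : X.Opens) (_ : y.1 ∈ V) (_ : V ≤ U) (s : Γ(X, V)),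
      toConst V s = Function.const ↥V φ := by
    obtain ⟨t, rfl⟩ := h y y.2
    obtain ⟨V, hV, s, rfl⟩ := X.presheaf.exists_germ_eq t
    refine ⟨V ⊓ U, ⟨hV, y.2⟩, inf_le_right, X.presheaf.map (homOfLE inf_le_left).op s, ?_⟩
    exact funext fun z ↦
      (toConst_map (homOfLE inf_le_left).op s z).trans (toConst_eq V s _ ⟨y, hV⟩)
  choose V hyV hVU s hs using hlocal
  obtain ⟨t, ht, -⟩ := X.sheaf.existsUnique_gluing' V U (fun y ↦ homOfLE (hVU y))
    (fun y hy ↦ Opens.mem_iSup.2 ⟨⟨y, hy⟩, hyV _⟩) s fun i j ↦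
      toConst_injective _ <| funext fun z ↦
        ((toConst_map (Opens.infLELeft (V i) (V j)).op (s i) z).trans (congrFun (hs i) _)).trans
        ((toConst_map (Opens.infLERight (V i) (V j)).op (s j) z).trans (congrFun (hs j) _)).symm
  refine ⟨t, funext fun y ↦ (toConst_map (homOfLE (hVU y)).op t ⟨y, hyV y⟩).symm.trans ?_⟩
  exact (congrArg (fun s ↦ toConst (V y) s ⟨y, hyV y⟩) (ht y)).trans (congrFun (hs y) _)

theorem isIntegrallyClosed_sections [IsNormalScheme X] (U : X.Opens) [Nonempty U] :
    IsIntegrallyClosed Γ(X, U) := by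
  have hinj : Function.Injective (algebraMap Γ(X, U) X.functionField) :=
    X.germToFunctionField_injective U
  have : FaithfulSMul Γ(X, U) X.functionField := (faithfulSMul_iff_algebraMap_injective _ _).2 hinj
  have : IsIntegrallyClosedIn Γ(X, U) X.functionField := by
    refine isIntegrallyClosedIn_iff.2 ⟨hinj, fun {φ} hφ ↦ ?_⟩
    obtain ⟨s, hs⟩ := exists_toConst_eq_const U φ fun y hy ↦ by
      have := IsNormalScheme.isIntegrallyClosed_stalk y
      let := X.presheaf.algebra_section_stalk (U := U) ⟨y, hy⟩
      have : IsScalarTower Γ(X, U) (X.presheaf.stalk y) X.functionField :=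
        functionField_isScalarTower X U ⟨y, hy⟩
      exact IsIntegrallyClosed.isIntegral_iff.1 (hφ.tower_top (A := X.presheaf.stalk y))
    exact ⟨s, (toConst_apply U s ⟨_, genericPoint_mem U⟩).symm.trans (congrFun hs _)⟩
  exact .of_isIntegrallyClosedIn Γ(X, U) X.functionField

variable [IsLocallyNoetherian X] [IsNormalScheme X]

theorem mem_range_stalk_of_forall_coheight_eq_one (U : X.Opens) (φ : X.functionField)
    (h : ∀ z ∈ U, coheight z = 1 → φ ∈ (algebraMap (X.presheaf.stalk z) X.functionField).range)
    (y : X) (hy : y ∈ U) : φ ∈ (algebraMap (X.presheaf.stalk y) X.functionField).range := by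
  obtain ⟨W, hW, hyW, hWU⟩ := exists_isAffineOpen_mem_and_subset hy
  have : Nonempty W := ⟨⟨y, hyW⟩⟩
  have := isIntegrallyClosed_sections W
  have := functionField_isFractionRing_of_isAffineOpen X W hW
  have : IsNoetherianRing Γ(X, W) := IsLocallyNoetherian.component_noetherian ⟨W, hW⟩
  have hφ : φ ∈ (1 : Submodule Γ(X, W) X.functionField) := by
    refine mem_one_of_forall_height_eq_one φ fun p hp hheight ↦ ?_
    let P : PrimeSpectrum Γ(X, W) := ⟨p, hp⟩
    have hP : hW.fromSpec P ∈ W := hW.range_fromSpec.subset (Set.mem_range_self P)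
    let := X.presheaf.algebra_section_stalk (U := W) ⟨_, hP⟩
    have : IsScalarTower Γ(X, W) (X.presheaf.stalk (hW.fromSpec P)) X.functionField :=
      functionField_isScalarTower X W ⟨_, hP⟩
    have : IsLocalization.AtPrime (X.presheaf.stalk (hW.fromSpec P)) p :=
      hW.isLocalization_stalk' P hP
    exact exists_notMem_smul_mem_one_of_mem_range p
      (h _ (hWU hP) ((coheight_fromSpec hW P).trans hheight))
  obtain ⟨s, rfl⟩ := Submodule.mem_one.1 hφ
  exact ⟨X.presheaf.germ W y hyW s, Scheme.algebraMap_germ_eq_germToFunctionField X hyW s⟩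

theorem exists_toConst_eq_const_of_forall_coheight_eq_one (U : X.Opens) (φ : X.functionField)
    (h : ∀ z ∈ U, coheight z = 1 → φ ∈ (algebraMap (X.presheaf.stalk z) X.functionField).range) :
    ∃ s : Γ(X, U), toConst U s = Function.const ↥U φ :=
  exists_toConst_eq_const U φ (mem_range_stalk_of_forall_coheight_eq_one U φ h)

end Hartogs

section DivisorSections

variable {Y : Scheme.{u}} [IsIntegral Y] [IsLocallyNoetherian Y] [IsNormalScheme Y]
  {E : WeilDivisor Y ℤ}

theorem one_mem_divisorSections (hE : 0 ≤ E) (U : Y.Opens) :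
    (1 : U → Y.functionField) ∈ divisorSections E U :=
  ⟨IsLocallyConstant.const 1, fun y _ ↦ Or.inr (by
    rw [Pi.one_apply, ord_one, zero_add]
    exact hE y.1)⟩

theorem toConst_mem_divisorSections (hE : 0 ≤ E) (U : Y.Opens) (r : Γ(Y, U)) :
    toConst U r ∈ divisorSections E U :=
  mul_one (toConst U r) ▸ toConst_mul_mem E U r (one_mem_divisorSections hE U)

theorem const_mem_divisorSections_iff {U : Y.Opens} {φ : Y.functionField} :
    Function.const ↥U φ ∈ divisorSections E U ↔
      ∀ y ∈ U, coheight y = 1 → φ = 0 ∨ 0 ≤ Scheme.ord φ y + E.1 y :=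
  ⟨fun h y hy ↦ h.2 ⟨y, hy⟩, fun h ↦ ⟨IsLocallyConstant.const φ, fun y ↦ h y.1 y.2⟩⟩

theorem const_mem_divisorSections_of_le {U V : Y.Opens} (h : U ≤ V) {φ : Y.functionField}
    (hφ : Function.const ↥V φ ∈ divisorSections E V) : Function.const ↥U φ ∈ divisorSections E U :=
  const_mem_divisorSections_iff.2 fun y hy ↦ const_mem_divisorSections_iff.1 hφ y (h hy)

theorem divisorSections_eq_const {U : Y.Opens} (s : divisorSections E U) (y : U) :
    s.1 = Function.const ↥U (s.1 y) := by
  have : Nonempty U := ⟨y⟩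
  exact funext fun z ↦ s.2.1.apply_eq_of_isPreconnected
    (PreirreducibleSpace.isPreirreducible_univ (X := U)).isPreconnected trivial trivial

variable (E) in
/-- The restriction of sections of `𝒪_Y(E)`. -/
def divisorSectionsRes {U V : Y.Opens} (h : U ≤ V) (s : divisorSections E V) :
    divisorSections E U :=
  (divisorPresheaf E).map (homOfLE h).op s

end DivisorSections

section SectionRetraction

variable {X Y : Scheme.{u}} [IsIntegral Y] [IsLocallyNoetherian Y] [IsNormalScheme Y]

/-- A retraction `f_* 𝒪_Y(E) → 𝒪_X` of the natural map, on the level of sections: a compatible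
family of `𝒪_X(U)`-linear maps `𝒪_Y(E)(f⁻¹ U) → 𝒪_X(U)` sending the section `1` to `1`. -/
structure SectionRetraction (f : Y ⟶ X) (E : WeilDivisor Y ℤ) where
  toFun (U : X.Opens) : divisorSections E (f ⁻¹ᵁ U) →+ Γ(X, U)
  map_res {U V : X.Opens} (h : U ≤ V) (s : divisorSections E (f ⁻¹ᵁ V)) :
    toFun U (divisorSectionsRes E (f.preimage_mono h) s) = X.presheaf.map (homOfLE h).op (toFun V s)
  map_smul (U : X.Opens) (c : Γ(X, U)) (s : divisorSections E (f ⁻¹ᵁ U)) :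
    toFun U (f.app U c • s) = c * toFun U s
  map_one (U : X.Opens) (s : divisorSections E (f ⁻¹ᵁ U)) : s.1 = 1 → toFun U s = 1

variable (f : Y ⟶ X) [IsFinite f] {Δ : WeilDivisor X ℚ} (hΔ : 0 ≤ Δ)

theorem plusMap_one (U : X.Opens) : (plusMap f Δ hΔ).val.app (.op U) (1 : Γ(X, U)) =
    (⟨1, one_mem_divisorSections (WeilDivisor.floor_pullback_nonneg f hΔ) (f ⁻¹ᵁ U)⟩ :
      divisorSections _ (f ⁻¹ᵁ U)) := by
  have hE := WeilDivisor.floor_pullback_nonneg f hΔ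
  have hunit : (SheafOfModules.unitToPushforwardObjUnit f.toRingCatSheafHom).val.app (.op U)
      (1 : Γ(X, U)) = (1 : Γ(Y, f ⁻¹ᵁ U)) :=
    map_one (f.app U).hom
  have hdivisor : (structureModuleToDivisorSheaf _ hE).val.app (.op (f ⁻¹ᵁ U))
      (1 : Γ(Y, f ⁻¹ᵁ U)) = (⟨1, one_mem_divisorSections hE (f ⁻¹ᵁ U)⟩ : divisorSections _ _) :=
    congrArg (fun s ↦ s.1 (.op (f ⁻¹ᵁ U)))
      ((SheafOfModules.unitHomEquiv (divisorSheaf _)).apply_symm_apply (oneSection _ hE))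
  exact (congrArg _ hunit).trans hdivisor

theorem nonempty_sectionRetraction_of_isSplitMono_plusMap [IsSplitMono (plusMap f Δ hΔ)] :
    Nonempty (SectionRetraction f (WeilDivisor.floor (WeilDivisor.pullback f Δ))) := by
  let ρ := retraction (plusMap f Δ hΔ)
  refine ⟨⟨fun U ↦ (ρ.app U).hom,
    fun h s ↦ PresheafOfModules.naturality_apply ρ.val (homOfLE h).op s,
    fun U c s ↦ Scheme.Modules.Hom.app_smul ρ c s, fun U s hs ↦ ?_⟩⟩
  have hone : (ρ.app U).hom ((plusMap f Δ hΔ).val.app (.op U) (1 : Γ(X, U))) = (1 : Γ(X, U)) :=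
    congrArg (fun ψ : structureModule X ⟶ structureModule X ↦ ψ.val.app (.op U) (1 : Γ(X, U)))
      (IsSplitMono.id (plusMap f Δ hΔ))
  rw [← hone, plusMap_one f hΔ U]
  exact congrArg _ (Subtype.ext hs)

theorem SectionRetraction.isSplitMono_plusMap
    (r : SectionRetraction f (WeilDivisor.floor (WeilDivisor.pullback f Δ))) :
    IsSplitMono (plusMap f Δ hΔ) := by
  let ρ : (Scheme.Modules.pushforward f).obj
      (divisorSheaf (WeilDivisor.floor (WeilDivisor.pullback f Δ))) ⟶ structureModule X :=
    ⟨PresheafOfModules.homMk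
      { app U := AddCommGrpCat.ofHom (r.toFun U.unop)
        naturality U V i := by
          ext s
          exact r.map_res i.unop.le s }
      fun U c s ↦ r.map_smul U.unop c s⟩
  refine ⟨⟨⟨ρ, (SheafOfModules.unitHomEquiv (structureModule X)).injective ?_⟩⟩⟩
  refine PresheafOfModules.sections_ext _ _ fun U ↦ ?_
  exact (congrArg (ρ.val.app U) (plusMap_one f hΔ U.unop)).trans (r.map_one U.unop _ rfl)

end SectionRetraction

section GenericSections

variable {X Y : Scheme.{u}} [IsIntegral X] [IsIntegral Y] (f : Y ⟶ X)

theorem exists_preimage_le [IsFinite f] [IsDominant f] (V : Y.Opens) [Nonempty V] :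
    ∃ U : X.Opens, genericPoint X ∈ U ∧ f ⁻¹ᵁ U ≤ V := by
  refine ⟨⟨(f '' (V : Set Y)ᶜ)ᶜ, (f.isClosedMap _ V.isOpen.isClosed_compl).isOpen_compl⟩, ?_,
    fun y hy ↦ by_contra fun hyV ↦ hy ⟨y, hyV, rfl⟩⟩
  rintro ⟨y, hyV, hy⟩
  have heq : genericPoint Y = y :=
    (f.isDiscrete_preimage_singleton (genericPoint X)).eq_of_specializes
      (genericPoint_specializes y) (map_genericPoint f) hy
  exact hyV (heq ▸ genericPoint_mem V)

theorem toConst_preimage_injective [IsDominant f] (U : X.Opens) {a b : Γ(X, U)}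
    (h : ∀ y : f ⁻¹ᵁ U, toConst U a ⟨f y, y.2⟩ = toConst U b ⟨f y, y.2⟩) : a = b := by
  refine toConst_injective U (funext fun x ↦ ?_)
  have : Nonempty U := ⟨x⟩
  obtain ⟨y⟩ := nonempty_preimage f U
  rw [toConst_eq U a x ⟨f y.1, y.2⟩, toConst_eq U b x ⟨f y.1, y.2⟩]
  exact h y

variable (X) in
theorem exists_toConst_eq_const_of_genericPoint (φ : X.functionField) :
    ∃ U : X.Opens, genericPoint X ∈ U ∧ ∃ s : Γ(X, U), toConst U s = Function.const ↥U φ := by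
  obtain ⟨U, hU, s, rfl⟩ := X.presheaf.exists_germ_eq φ
  have : Nonempty U := ⟨⟨_, hU⟩⟩
  exact ⟨U, hU, s, funext fun x ↦ toConst_apply U s x⟩

variable [IsLocallyNoetherian Y] [IsNormalScheme Y] {E : WeilDivisor Y ℤ}

theorem exists_const_mem_divisorSections [IsFinite f] [IsDominant f] (hE : 0 ≤ E)
    (φ : Y.functionField) : ∃ U : X.Opens, genericPoint X ∈ U ∧
      Function.const ↥(f ⁻¹ᵁ U) φ ∈ divisorSections E (f ⁻¹ᵁ U) := by
  obtain ⟨V, hV, s, hs⟩ := exists_toConst_eq_const_of_genericPoint Y φ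
  have : Nonempty V := ⟨⟨_, hV⟩⟩
  obtain ⟨U, hU, hUV⟩ := exists_preimage_le f V
  exact ⟨U, hU, const_mem_divisorSections_of_le hUV (hs ▸ toConst_mem_divisorSections hE V s)⟩

end GenericSections

section FunctionFieldHom

variable {X Y : Scheme.{u}} [IsIntegral X] [IsIntegral Y] [IsLocallyNoetherian Y]
  [IsNormalScheme Y] {f : Y ⟶ X} {E : WeilDivisor Y ℤ}

namespace SectionRetraction

variable (r : SectionRetraction f E)

theorem toConst_toFun_of_le {U V : X.Opens} (h : U ≤ V) {φ : Y.functionField}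
    (hV : Function.const ↥(f ⁻¹ᵁ V) φ ∈ divisorSections E (f ⁻¹ᵁ V)) (x : U) :
    toConst U (r.toFun U ⟨_, const_mem_divisorSections_of_le (f.preimage_mono h) hV⟩) x =
      toConst V (r.toFun V ⟨_, hV⟩) ⟨x, h x.2⟩ :=
  (congrArg (toConst U · x) (r.map_res h ⟨_, hV⟩)).trans (toConst_map (homOfLE h).op _ x)

theorem toConst_toFun_eq {U V : X.Opens} {φ : Y.functionField}
    (hU : Function.const ↥(f ⁻¹ᵁ U) φ ∈ divisorSections E (f ⁻¹ᵁ U))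
    (hV : Function.const ↥(f ⁻¹ᵁ V) φ ∈ divisorSections E (f ⁻¹ᵁ V)) (x : U) (y : V) :
    toConst U (r.toFun U ⟨_, hU⟩) x = toConst V (r.toFun V ⟨_, hV⟩) y := by
  have : Nonempty U := ⟨x⟩
  have : Nonempty V := ⟨y⟩
  let η : ↥(U ⊓ V) := ⟨genericPoint X, genericPoint_mem U, genericPoint_mem V⟩
  rw [toConst_eq U _ x ⟨η, η.2.1⟩, toConst_eq V _ y ⟨η, η.2.2⟩,
    ← r.toConst_toFun_of_le inf_le_left hU η, ← r.toConst_toFun_of_le inf_le_right hV η]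

variable [IsFinite f] [IsDominant f] (hE : 0 ≤ E)

/-- The value at `φ ∈ K(Y)` of the map `K(Y) → K(X)` induced by a retraction
`f_* 𝒪_Y(E) → 𝒪_X`: every `φ` is a section of `𝒪_Y(E)` over the preimage of a nonempty open
subset of `X`, and the choice of this open subset does not matter. -/
def genericValue (φ : Y.functionField) : X.functionField :=
  toConst _ (r.toFun _ ⟨_, (exists_const_mem_divisorSections f hE φ).choose_spec.2⟩)
    ⟨genericPoint X, (exists_const_mem_divisorSections f hE φ).choose_spec.1⟩

theorem genericValue_eq {U : X.Opens} {φ : Y.functionField}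
    (hU : Function.const ↥(f ⁻¹ᵁ U) φ ∈ divisorSections E (f ⁻¹ᵁ U)) (x : U) :
    r.genericValue hE φ = toConst U (r.toFun U ⟨_, hU⟩) x :=
  r.toConst_toFun_eq _ hU _ x

theorem genericValue_add (φ ψ : Y.functionField) :
    r.genericValue hE (φ + ψ) = r.genericValue hE φ + r.genericValue hE ψ := by
  obtain ⟨U, hηU, hU⟩ := exists_const_mem_divisorSections f hE φ
  obtain ⟨V, hηV, hV⟩ := exists_const_mem_divisorSections f hE ψ
  replace hU := const_mem_divisorSections_of_le (f.preimage_mono (inf_le_left (b := V))) hU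
  replace hV := const_mem_divisorSections_of_le (f.preimage_mono (inf_le_right (a := U))) hV
  let η : ↥(U ⊓ V) := ⟨genericPoint X, hηU, hηV⟩
  rw [r.genericValue_eq hE (add_mem hU hV) η, r.genericValue_eq hE hU η,
    r.genericValue_eq hE hV η, ← Pi.add_apply, ← map_add, ← map_add]
  rfl

theorem genericValue_mul (c : X.functionField) (φ : Y.functionField) :
    r.genericValue hE (functionFieldMap f c * φ) = c * r.genericValue hE φ := by
  obtain ⟨U, hηU, s, hs⟩ := exists_toConst_eq_const_of_genericPoint X c
  obtain ⟨V, hηV, hV⟩ := exists_const_mem_divisorSections f hE φ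
  let t : Γ(X, U ⊓ V) := X.presheaf.map (homOfLE inf_le_left).op s
  have ht (x : ↥(U ⊓ V)) : toConst (U ⊓ V) t x = c :=
    (toConst_map (homOfLE inf_le_left).op s x).trans (congrFun hs _)
  replace hV := const_mem_divisorSections_of_le (f.preimage_mono (inf_le_right (a := U))) hV
  have hmul : toConst _ (f.app (U ⊓ V) t) * Function.const ↥(f ⁻¹ᵁ (U ⊓ V)) φ =
      Function.const _ (functionFieldMap f c * φ) :=
    funext fun y ↦ congrArg (· * φ) <|
      (functionFieldMap_toConst f (U ⊓ V) t y).symm.trans (congrArg _ (ht ⟨f y, y.2⟩))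
  have hmem := hmul ▸ toConst_mul_mem E _ (f.app (U ⊓ V) t) hV
  have hsmul : (⟨_, hmem⟩ : divisorSections E (f ⁻¹ᵁ (U ⊓ V))) = f.app (U ⊓ V) t • ⟨_, hV⟩ :=
    Subtype.ext hmul.symm
  let η : ↥(U ⊓ V) := ⟨genericPoint X, hηU, hηV⟩
  rw [r.genericValue_eq hE hmem η, hsmul, r.map_smul, map_mul, Pi.mul_apply, ht,
    r.genericValue_eq hE hV η]

theorem genericValue_one : r.genericValue hE 1 = 1 := by
  have hone : Function.const ↥(f ⁻¹ᵁ ⊤) 1 ∈ divisorSections E (f ⁻¹ᵁ ⊤) :=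
    one_mem_divisorSections hE _
  rw [r.genericValue_eq hE hone ⟨genericPoint X, Opens.mem_top _⟩, r.map_one ⊤ _ rfl]
  exact congrFun (toConst ⊤).map_one _

end SectionRetraction

/-- A `K(X)`-linear retraction `ρ` of `K(X) → K(Y)` that maps sections of `f_* 𝒪_Y(E)` to
sections of `𝒪_X`. By Hartogs' lemma, on a normal locally Noetherian scheme `X` the latter can be
tested at the points of codimension one, which is what is recorded here. -/
structure IsDivisorRetraction (f : Y ⟶ X) [IsDominant f] (E : WeilDivisor Y ℤ)
    (ρ : Y.functionField →+ X.functionField) : Prop where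
  map_mul (c : X.functionField) (φ : Y.functionField) : ρ (functionFieldMap f c * φ) = c * ρ φ
  map_one : ρ 1 = 1
  mem_range {U : X.Opens} {φ : Y.functionField} :
    Function.const ↥(f ⁻¹ᵁ U) φ ∈ divisorSections E (f ⁻¹ᵁ U) →
      ∀ x ∈ U, coheight x = 1 → ρ φ ∈ (algebraMap (X.presheaf.stalk x) X.functionField).range

theorem SectionRetraction.exists_isDivisorRetraction [IsFinite f] [IsDominant f]
    (r : SectionRetraction f E) (hE : 0 ≤ E) : ∃ ρ, IsDivisorRetraction f E ρ :=
  ⟨AddMonoidHom.mk' (r.genericValue hE) (r.genericValue_add hE),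
    { map_mul := r.genericValue_mul hE
      map_one := r.genericValue_one hE
      mem_range := fun {U _} hφ x hx _ ↦
        ⟨X.presheaf.germ U x hx (r.toFun U ⟨_, hφ⟩), (r.genericValue_eq hE hφ ⟨x, hx⟩).symm⟩ }⟩

theorem exists_isDivisorRetraction_of_isSplitMono_plusMap [IsFinite f] [IsDominant f]
    {Δ : WeilDivisor X ℚ} (hΔ : 0 ≤ Δ) [IsSplitMono (plusMap f Δ hΔ)] :
    ∃ ρ, IsDivisorRetraction f (WeilDivisor.floor (WeilDivisor.pullback f Δ)) ρ := by
  obtain ⟨r⟩ := nonempty_sectionRetraction_of_isSplitMono_plusMap f hΔ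
  exact r.exists_isDivisorRetraction (WeilDivisor.floor_pullback_nonneg f hΔ)

variable [IsLocallyNoetherian X] [IsNormalScheme X] [IsDominant f]
  {ρ : Y.functionField →+ X.functionField}

theorem IsDivisorRetraction.exists_toConst_eq (hρ : IsDivisorRetraction f E ρ) (U : X.Opens)
    (s : divisorSections E (f ⁻¹ᵁ U)) :
    ∃ c : Γ(X, U), ∀ y : f ⁻¹ᵁ U, toConst U c ⟨f y, y.2⟩ = ρ (s.1 y) := by
  rcases isEmpty_or_nonempty ↥(f ⁻¹ᵁ U) with hempty | ⟨⟨y⟩⟩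
  · exact ⟨0, fun y ↦ hempty.elim y⟩
  have hs := divisorSections_eq_const s y
  obtain ⟨c, hc⟩ := exists_toConst_eq_const_of_forall_coheight_eq_one U (ρ (s.1 y))
    (hρ.mem_range (hs ▸ s.2))
  exact ⟨c, fun z ↦ (congrFun hc _).trans (congrArg ρ (congrFun hs z).symm)⟩

theorem IsDivisorRetraction.nonempty_sectionRetraction (hρ : IsDivisorRetraction f E ρ) :
    Nonempty (SectionRetraction f E) := by
  choose r hr using hρ.exists_toConst_eq
  refine ⟨fun U ↦ AddMonoidHom.mk' (r U) fun s t ↦ ?_, fun {U V} h s ↦ ?_, fun U c s ↦ ?_,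
    fun U s hs ↦ ?_⟩ <;> refine toConst_preimage_injective f U fun y ↦ (hr U _ y).trans ?_
  · rw [map_add, Pi.add_apply, hr, hr, ← map_add]
    rfl
  · exact (hr V s ⟨y, h y.2⟩).symm.trans (toConst_map (homOfLE h).op (r V s) ⟨f y, y.2⟩).symm
  · have hsmul : ρ ((f.app U c • s).1 y) =
        ρ (functionFieldMap f (toConst U c ⟨f y, y.2⟩) * s.1 y) :=
      congrArg (ρ <| · * s.1 y) (functionFieldMap_toConst f U c y).symm
    rw [hsmul, hρ.map_mul, ← hr U s y]
    exact (congrFun ((toConst U).map_mul c (r U s)) _).symm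
  · exact ((congrArg ρ (congrFun hs y)).trans hρ.map_one).trans
      (congrFun (toConst U).map_one _).symm

theorem IsDivisorRetraction.isSplitMono_plusMap [IsFinite f] {Δ : WeilDivisor X ℚ} (hΔ : 0 ≤ Δ)
    (hρ : IsDivisorRetraction f (WeilDivisor.floor (WeilDivisor.pullback f Δ)) ρ) :
    IsSplitMono (plusMap f Δ hΔ) := by
  obtain ⟨r⟩ := hρ.nonempty_sectionRetraction
  exact r.isSplitMono_plusMap f hΔ

end FunctionFieldHom

namespace WeilDivisor

variable {U X : Scheme.{u}} (j : U ⟶ X) [IsOpenImmersion j] {R : Type*} [AddCommGroup R]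

/-- The restriction of a Weil divisor on `X` along an open immersion `j : U ⟶ X`. -/
def restrict (D : WeilDivisor X R) : WeilDivisor U R where
  val :=
    { toFun u := D.1 (j u)
      supportWithinDomain' := fun _ _ ↦ trivial
      supportLocallyFiniteWithinDomain' := fun z _ ↦ by
        obtain ⟨t, ht, hfin⟩ := D.1.supportLocallyFiniteWithinDomain (j z) trivial
        exact ⟨j ⁻¹' t, j.continuous.continuousAt.preimage_mem_nhds ht,
          hfin.preimage (f := j) j.isOpenEmbedding.injective.injOn⟩ }
  property u hu := (coheight_eq_of_isOpenImmersion j).symm.trans (D.2 (j u) hu)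

theorem restrict_add (D E : WeilDivisor X R) : restrict j (D + E) = restrict j D + restrict j E :=
  rfl

theorem restrict_ratSMul (ε : ℚ) (D : WeilDivisor X ℤ) :
    restrict j (ratSMul ε D) = ratSMul ε (restrict j D) :=
  rfl

theorem nonneg_of_restrict_nonneg [PartialOrder R] (hj : ∀ x : X, coheight x = 1 → x ∈ Set.range j)
    {D : WeilDivisor X R} (hD : 0 ≤ restrict j D) : 0 ≤ D := by
  intro x
  by_cases hx : coheight x = 1
  · obtain ⟨u, rfl⟩ := hj x hx
    exact hD u
  · exact (not_not.1 (mt (D.2 x) hx)).ge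

theorem floor_pullback_restrict {S Q Z X : Scheme.{u}} {j : Q ⟶ S} {h : S ⟶ X} {q : Q ⟶ Z}
    {a : Z ⟶ X} [IsOpenImmersion j] [IsOpenImmersion a] [IsFinite h] [IsFinite q]
    (hcomm : j ≫ h = q ≫ a) (D : WeilDivisor X ℚ) :
    floor (pullback q (restrict a D)) = restrict j (floor (pullback h D)) := by
  refine Subtype.ext (Function.locallyFinsuppWithin.ext fun y ↦ ?_)
  have hramification : ramificationIndex h (j y) = ramificationIndex q y := by
    rw [← ramificationIndex_comp_of_isOpenImmersion_left, hcomm,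
      ramificationIndex_comp_of_isOpenImmersion_right]
  have hcoeff : D.1 (h (j y)) = D.1 (a (q y)) := by
    rw [← Scheme.Hom.comp_apply, hcomm, Scheme.Hom.comp_apply]
  change ⌊if coheight y = 1 then (ramificationIndex q y : ℚ) * D.1 (a (q y)) else 0⌋ =
    ⌊if coheight (j y) = 1 then (ramificationIndex h (j y) : ℚ) * D.1 (h (j y)) else 0⌋
  rw [hramification, hcoeff, coheight_eq_of_isOpenImmersion]

end WeilDivisor

section Transfer

theorem const_mem_divisorSections_restrict_iff {S Q : Scheme.{u}} [IsIntegral S] [IsIntegral Q]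
    [IsLocallyNoetherian S] [IsLocallyNoetherian Q] [IsNormalScheme S] [IsNormalScheme Q]
    (j : Q ⟶ S) [IsOpenImmersion j] [IsDominant j] {E : WeilDivisor S ℤ} {V : Q.Opens}
    {φ : S.functionField} :
    Function.const ↥V (functionFieldMap j φ) ∈ divisorSections (WeilDivisor.restrict j E) V ↔
      Function.const ↥(j ''ᵁ V) φ ∈ divisorSections E (j ''ᵁ V) := by
  have hpoint (y : Q) : (coheight y = 1 → functionFieldMap j φ = 0 ∨
      0 ≤ Scheme.ord (functionFieldMap j φ) y + E.1 (j y)) ↔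
        (coheight (j y) = 1 → φ = 0 ∨ 0 ≤ Scheme.ord φ (j y) + E.1 (j y)) := by
    rw [ord_functionFieldMap, map_eq_zero, coheight_eq_of_isOpenImmersion]
  rw [const_mem_divisorSections_iff, const_mem_divisorSections_iff]
  refine ⟨?_, fun h y hy ↦ (hpoint y).2 (h (j y) ⟨y, hy, rfl⟩)⟩
  rintro h _ ⟨y, hy, rfl⟩
  exact (hpoint y).1 (h y hy)

variable {S Q Z X : Scheme.{u}} [IsIntegral S] [IsIntegral Q] [IsIntegral Z] [IsIntegral X]
  [IsLocallyNoetherian S] [IsLocallyNoetherian Q] [IsNormalScheme S] [IsNormalScheme Q]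
  {j : Q ⟶ S} {h : S ⟶ X} {q : Q ⟶ Z} {a : Z ⟶ X} [IsOpenImmersion j] [IsOpenImmersion a]
  [IsDominant h] [IsDominant q] {E : WeilDivisor S ℤ}

theorem exists_isDivisorRetraction_restrict (hpb : IsPullback q j a h)
    {ρ : S.functionField →+ X.functionField} (hρ : IsDivisorRetraction h E ρ) :
    ∃ ρ', IsDivisorRetraction q (WeilDivisor.restrict j E) ρ' := by
  have := isDominant_of_isOpenImmersion a
  have := isDominant_of_isOpenImmersion j
  have hcomm := functionFieldMap_comm hpb.w.symm
  let ρ' : Q.functionField →+ Z.functionField := (functionFieldMap a).toAddMonoidHom.comp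
    (ρ.comp (functionFieldEquiv j).symm.toAddEquiv.toAddMonoidHom)
  have hρ' (φ : S.functionField) : ρ' (functionFieldMap j φ) = functionFieldMap a (ρ φ) :=
    congrArg (fun ψ ↦ functionFieldMap a (ρ ψ)) ((functionFieldEquiv j).symm_apply_apply φ)
  refine ⟨ρ', fun c φ ↦ ?_, ?_, fun {U φ} hφ z hz hz1 ↦ ?_⟩
  · obtain ⟨c, rfl⟩ := (functionFieldEquiv a).surjective c
    obtain ⟨φ, rfl⟩ := (functionFieldEquiv j).surjective φ
    simp only [functionFieldEquiv_apply]
    rw [← hcomm, ← map_mul, hρ', hρ', hρ.map_mul, map_mul]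
  · rw [← map_one (functionFieldMap j), hρ', hρ.map_one, map_one]
  · obtain ⟨φ, rfl⟩ := (functionFieldEquiv j).surjective φ
    rw [functionFieldEquiv_apply, const_mem_divisorSections_restrict_iff] at hφ
    rw [functionFieldEquiv_apply, hρ', functionFieldMap_mem_range_iff]
    have hpre := IsOpenImmersion.image_preimage_eq_preimage_image_of_isPullback hpb U
    exact hρ.mem_range (const_mem_divisorSections_of_le hpre.ge hφ) (a z) ⟨z, hz, rfl⟩
      ((coheight_eq_of_isOpenImmersion a).trans hz1)

theorem exists_isDivisorRetraction_of_restrict (hcomm : j ≫ h = q ≫ a)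
    (ha : ∀ x : X, coheight x = 1 → x ∈ Set.range a)
    {ρ : Q.functionField →+ Z.functionField}
    (hρ : IsDivisorRetraction q (WeilDivisor.restrict j E) ρ) :
    ∃ ρ', IsDivisorRetraction h E ρ' := by
  have := isDominant_of_isOpenImmersion a
  have := isDominant_of_isOpenImmersion j
  let ρ' : S.functionField →+ X.functionField :=
    (functionFieldEquiv a).symm.toAddEquiv.toAddMonoidHom.comp
      (ρ.comp (functionFieldMap j).toAddMonoidHom)
  have hρ' (φ : S.functionField) : functionFieldMap a (ρ' φ) = ρ (functionFieldMap j φ) :=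
    (functionFieldEquiv a).apply_symm_apply _
  refine ⟨ρ', fun c φ ↦ (functionFieldMap a).injective ?_, (functionFieldMap a).injective ?_,
    fun {U φ} hφ x hx hx1 ↦ ?_⟩
  · rw [hρ', map_mul (functionFieldMap j), functionFieldMap_comm hcomm, hρ.map_mul, ← hρ',
      ← map_mul]
  · rw [hρ', map_one, hρ.map_one, map_one]
  · obtain ⟨z, rfl⟩ := ha x hx1
    rw [← functionFieldMap_mem_range_iff, hρ']
    refine hρ.mem_range (U := a ⁻¹ᵁ U) ?_ z hx ((coheight_eq_of_isOpenImmersion a).symm.trans hx1)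
    refine (const_mem_divisorSections_restrict_iff j).2 (const_mem_divisorSections_of_le ?_ hφ)
    rintro _ ⟨y, hy, rfl⟩
    have hpoint : h (j y) = a (q y) := by
      rw [← Scheme.Hom.comp_apply, hcomm, Scheme.Hom.comp_apply]
    exact (congrArg (· ∈ U) hpoint).mpr hy

end Transfer

section Normalization

theorem isNormalScheme_of_isOpenImmersion {X Y : Scheme.{u}} [IsNormalScheme X] (f : Y ⟶ X)
    [IsOpenImmersion f] : IsNormalScheme Y where
  isDomain_stalk y :=
    have := IsNormalScheme.isDomain_stalk (f y)
    (asIso (f.stalkMap y)).commRingCatIsoToRingEquiv.symm.toMulEquiv.isDomain _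
  isIntegrallyClosed_stalk y :=
    have := IsNormalScheme.isIntegrallyClosed_stalk (f y)
    .of_equiv (asIso (f.stalkMap y)).commRingCatIsoToRingEquiv

theorem isNormalScheme_of_isIntegrallyClosed {X : Scheme.{u}} [IsIntegral X]
    (h : ∀ x : X, ∃ U : X.Opens, x ∈ U ∧ IsAffineOpen U ∧ IsIntegrallyClosed Γ(X, U)) :
    IsNormalScheme X where
  isDomain_stalk _ := inferInstance
  isIntegrallyClosed_stalk x := by
    obtain ⟨U, hxU, hU, hclosed⟩ := h x
    have : Nonempty U := ⟨⟨x, hxU⟩⟩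
    let := X.presheaf.algebra_section_stalk (U := U) ⟨x, hxU⟩
    have := hU.isLocalization_stalk ⟨x, hxU⟩
    exact isIntegrallyClosed_of_isLocalization (X.presheaf.stalk x) _
      (Ideal.primeCompl_le_nonZeroDivisors (hU.primeIdealOf ⟨x, hxU⟩).asIdeal)

theorem isNormalScheme_normalization {X Q : Scheme.{u}} [IsIntegral Q] [IsNormalScheme Q]
    (f : Q ⟶ X) [QuasiCompact f] [QuasiSeparated f] : IsNormalScheme f.normalization := by
  refine isNormalScheme_of_isIntegrallyClosed fun s ↦ ?_
  obtain ⟨W, hW, hsW, -⟩ :=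
    exists_isAffineOpen_mem_and_subset (Opens.mem_top (f.fromNormalization s))
  refine ⟨f.fromNormalization ⁻¹ᵁ W, hsW, hW.preimage _, ?_⟩
  have : Nonempty (f ⁻¹ᵁ W) := by
    have : Nonempty (f.fromNormalization ⁻¹ᵁ W) := ⟨⟨s, hsW⟩⟩
    have h := nonempty_preimage f.toNormalization (f.fromNormalization ⁻¹ᵁ W)
    rwa [← Scheme.Hom.comp_preimage, f.toNormalization_fromNormalization] at h
  have := isIntegrallyClosed_sections (f ⁻¹ᵁ W)
  let := (f.app W).hom.toAlgebra
  have : IsIntegrallyClosed (integralClosure Γ(X, W) Γ(Q, f ⁻¹ᵁ W)) :=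
    .of_isIntegrallyClosed_of_isIntegrallyClosedIn _ Γ(Q, f ⁻¹ᵁ W)
  exact .of_equiv (f.normalizationObjIso hW).symm.commRingCatIsoToRingEquiv

theorem algebraMap_functionFieldMap {X Y : Scheme.{u}} [IsIntegral X] [IsIntegral Y] (f : Y ⟶ X)
    [IsDominant f] (U : X.Opens) [Nonempty U] (s : Γ(X, U)) :
    functionFieldMap f (algebraMap Γ(X, U) X.functionField s) =
      algebraMap Γ(Y, f ⁻¹ᵁ U) Y.functionField (f.app U s) := by
  obtain ⟨y⟩ := nonempty_preimage f U
  exact (congrArg _ (toConst_apply U s ⟨f y.1, y.2⟩).symm).trans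
    ((functionFieldMap_toConst f U s y).trans (toConst_apply _ _ y))

theorem finite_functionFieldMap {X Y : Scheme.{u}} [IsIntegral X] [IsIntegral Y] (f : Y ⟶ X)
    [IsFinite f] [IsDominant f] : (functionFieldMap f).Finite := by
  obtain ⟨W, hW, hxW, -⟩ := exists_isAffineOpen_mem_and_subset (Opens.mem_top (genericPoint X))
  have : Nonempty W := ⟨⟨_, hxW⟩⟩
  have := functionField_isFractionRing_of_isAffineOpen X W hW
  have := functionField_isFractionRing_of_isAffineOpen Y _ (hW.preimage f)
  algebraize [(f.app W).hom, functionFieldMap f,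
    (algebraMap Γ(Y, f ⁻¹ᵁ W) Y.functionField).comp (f.app W).hom]
  have hcomm := algebraMap_functionFieldMap f W
  have : IsScalarTower Γ(X, W) X.functionField Y.functionField :=
    .of_algebraMap_eq fun s ↦ (hcomm s).symm
  have := FaithfulSMul.trans Γ(X, W) X.functionField Y.functionField
  have := FaithfulSMul.tower_bot Γ(X, W) Γ(Y, f ⁻¹ᵁ W) Y.functionField
  have : Module.Finite Γ(X, W) Γ(Y, f ⁻¹ᵁ W) := f.finite_app W hW
  have := Algebra.IsAlgebraic.isBaseChange_of_isFractionRing Γ(X, W) Γ(Y, f ⁻¹ᵁ W)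
    X.functionField Y.functionField
  exact RingHom.finite_algebraMap.2 (Module.Finite.equiv this.equiv)

theorem isFinite_fromNormalization {X Q : Scheme.{u}} [IsIntegral X] [IsNagataScheme X]
    [IsIntegral Q] (f : Q ⟶ X) [QuasiCompact f] [QuasiSeparated f] [IsDominant f]
    (hf : (functionFieldMap f).Finite) : IsFinite f.fromNormalization := by
  refine (IsFinite.iff_isIntegralHom_and_locallyOfFiniteType _).2 ⟨inferInstance, ?_⟩
  rw [HasRingHomProperty.iff_exists_appLE (P := @LocallyOfFiniteType)
    (RingHom.finiteType_stableUnderComposition.stableUnderCompositionWithLocalizationAway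
      RingHom.finiteType_holdsForLocalizationAway).1]
  intro s
  obtain ⟨W, hsW, hW, hN⟩ := IsNagataScheme.exists_isNagataRing (f.fromNormalization s)
  refine ⟨⟨W, hW⟩, ⟨_, hW.preimage f.fromNormalization⟩, hsW, le_rfl, ?_⟩
  rw [Scheme.Hom.appLE_eq_app, f.fromNormalization_app hW]
  refine (RingHom.finiteType_respectsIso.cancel_right_isIso _ _).2 ?_
  have : Nonempty W := ⟨⟨_, hsW⟩⟩
  have := functionField_isFractionRing_of_isAffineOpen X W hW
  algebraize [(f.app W).hom, functionFieldMap f,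
    (algebraMap Γ(Q, f ⁻¹ᵁ W) Q.functionField).comp (f.app W).hom]
  have : IsScalarTower Γ(X, W) X.functionField Q.functionField :=
    .of_algebraMap_eq fun s ↦ (algebraMap_functionFieldMap f W s).symm
  have := hN.1
  have := hN.finite_integralClosure X.functionField Q.functionField
  have := finite_integralClosure_of_injective (A := Γ(X, W))
    (IsScalarTower.toAlgHom Γ(X, W) Γ(Q, f ⁻¹ᵁ W) Q.functionField)
    (Q.germToFunctionField_injective _)
  exact (RingHom.finite_algebraMap.2 this).finiteType

end Normalization

section Extension

theorem isPullback_of_isFinite {X Z S Q : Scheme.{u}} [IsIntegral S] [IsIntegral Q]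
    {j : Q ⟶ S} {h : S ⟶ X} {q : Q ⟶ Z} {a : Z ⟶ X} [IsOpenImmersion j] [IsOpenImmersion a]
    [IsFinite q] [IsSeparated h] (hcomm : j ≫ h = q ≫ a) : IsPullback q j a h := by
  let l : Q ⟶ Limits.pullback a h := Limits.pullback.lift q j hcomm.symm
  have hfst : l ≫ Limits.pullback.fst a h = q := Limits.pullback.lift_fst ..
  have hsnd : l ≫ Limits.pullback.snd a h = j := Limits.pullback.lift_snd ..
  have : IsOpenImmersion (l ≫ Limits.pullback.snd a h) := hsnd ▸ inferInstance
  have : IsOpenImmersion l := .of_comp l (Limits.pullback.snd a h)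
  have : IsFinite (l ≫ Limits.pullback.fst a h) := hfst ▸ inferInstance
  have : IsFinite l := .of_comp l (Limits.pullback.fst a h)
  have : Nonempty (Limits.pullback a h : Scheme.{u}) := ⟨l (genericPoint Q)⟩
  have : IsIntegral (Limits.pullback a h) :=
    isIntegral_of_isOpenImmersion (Limits.pullback.snd a h)
  have := isDominant_of_isOpenImmersion l
  have : IsIso l := (isIso_iff_isOpenImmersion_and_surjective l).2 ⟨inferInstance, inferInstance⟩
  exact .of_iso_pullback ⟨hcomm.symm⟩ (asIso l) hfst hsnd

theorem exists_isPullback_of_isFinite {X Z Q : Scheme.{u}} [IsIntegral X] [IsLocallyNoetherian X]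
    [IsNagataScheme X] [IsIntegral Z] [IsIntegral Q] [IsNormalScheme Q] (a : Z ⟶ X)
    [IsOpenImmersion a] (q : Q ⟶ Z) [IsFinite q] [IsDominant q] :
    ∃ (S : Scheme.{u}) (_ : IsIntegral S) (_ : IsLocallyNoetherian S) (_ : IsNormalScheme S)
      (h : S ⟶ X) (_ : IsFinite h) (_ : IsDominant h) (j : Q ⟶ S) (_ : IsOpenImmersion j),
      IsPullback q j a h := by
  have := isDominant_of_isOpenImmersion a
  have := isNormalScheme_normalization (q ≫ a)
  have hfinite : (functionFieldMap (q ≫ a)).Finite := by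
    have hcomp : functionFieldMap (q ≫ a) = (functionFieldMap q).comp (functionFieldMap a) :=
      RingHom.ext (functionFieldMap_comp a q)
    rw [hcomp]
    exact (finite_functionFieldMap q).comp
      (.of_surjective _ (functionFieldMap_bijective a).surjective)
  have := isFinite_fromNormalization (q ≫ a) hfinite
  have hcomm : (q ≫ a).toNormalization ≫ (q ≫ a).fromNormalization = q ≫ a :=
    (q ≫ a).toNormalization_fromNormalization
  have : IsDominant ((q ≫ a).toNormalization ≫ (q ≫ a).fromNormalization) := by
    rw [hcomm]
    infer_instance
  -- The morphism `q ≫ a` is quasi-finite, so this instance is Zariski's main theorem.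
  have : IsOpenImmersion (q ≫ a).toNormalization := inferInstance
  exact ⟨_, inferInstance, LocallyOfFiniteType.isLocallyNoetherian (q ≫ a).fromNormalization,
    inferInstance, (q ≫ a).fromNormalization, inferInstance,
    .of_comp (q ≫ a).toNormalization _, (q ≫ a).toNormalization, inferInstance,
    isPullback_of_isFinite hcomm⟩

end Extension

section PlusRegularity

theorem IsGloballyPlusRegular.of_restrict_eq {X Y Z : Scheme.{u}} [IsIntegral X]
    [IsLocallyNoetherian X] [IsNagataScheme X] [IsIntegral Y] [IsLocallyNoetherian Y]
    [IsNormalScheme Y] [IsIntegral Z] {a : Z ⟶ X} {b : Z ⟶ Y} [IsOpenImmersion a]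
    [IsOpenImmersion b] (hb : ∀ y : Y, coheight y = 1 → y ∈ Set.range b) {Δ : WeilDivisor X ℚ}
    {Θ : WeilDivisor Y ℚ} (hΔΘ : WeilDivisor.restrict a Δ = WeilDivisor.restrict b Θ)
    (hX : IsGloballyPlusRegular X Δ) : IsGloballyPlusRegular Y Θ := by
  obtain ⟨hΔ, hX⟩ := hX
  have hΘ : 0 ≤ Θ := WeilDivisor.nonneg_of_restrict_nonneg b hb (hΔΘ ▸ fun z ↦ hΔ (a z))
  refine ⟨hΘ, fun T _ _ _ g _ _ ↦ ?_⟩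
  let i := Limits.pullback.fst g b
  let q := Limits.pullback.snd g b
  have : Nonempty (Limits.pullback g b : Scheme.{u}) := ⟨(q.surjective (genericPoint Z)).choose⟩
  have : IsIntegral (Limits.pullback g b) := isIntegral_of_isOpenImmersion i
  have := isNormalScheme_of_isOpenImmersion i
  obtain ⟨S, _, _, _, h, _, _, j, _, hpb⟩ := exists_isPullback_of_isFinite a q
  have := hX S h
  obtain ⟨ρ, hρ⟩ := exists_isDivisorRetraction_of_isSplitMono_plusMap (f := h) hΔ
  obtain ⟨ρ', hρ'⟩ := exists_isDivisorRetraction_restrict hpb hρ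
  rw [← WeilDivisor.floor_pullback_restrict hpb.w.symm, hΔΘ,
    WeilDivisor.floor_pullback_restrict Limits.pullback.condition] at hρ'
  obtain ⟨ρ'', hρ''⟩ := exists_isDivisorRetraction_of_restrict Limits.pullback.condition hb hρ'
  exact hρ''.isSplitMono_plusMap hΘ

end PlusRegularity

namespace WeilDivisor

variable {X Y : Scheme.{u}} (f : X.PartialIso Y)

theorem restrict_pushforward [IsLocallyNoetherian Y] (D : WeilDivisor X ℚ) :
    restrict f.target.ι (pushforward f D) = restrict (f.iso.inv ≫ f.source.ι) D :=
  Subtype.ext (Function.locallyFinsuppWithin.ext fun y ↦ dif_pos y.2)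

theorem pushforward_nonneg [IsLocallyNoetherian Y] {D : WeilDivisor X ℚ} (hD : 0 ≤ D) :
    0 ≤ pushforward f D := by
  intro y
  by_cases hy : y ∈ f.target
  · have h : (pushforward f D).1 y = D.1 ((f.iso.inv ≫ f.source.ι) ⟨y, hy⟩) := dif_pos hy
    exact (hD _).trans_eq h.symm
  · have h : (pushforward f D).1 y = 0 := dif_neg hy
    exact h.ge

variable [IsLocallyNoetherian X]

/-- The strict transform on `X` of an integral divisor on `Y` along a birational map `f`. It is
obtained by rounding down, since `pushforward` is defined for `ℚ`-divisors. -/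
def strictTransform (D : WeilDivisor Y ℤ) : WeilDivisor X ℤ :=
  floor (pushforward f.symm (ratSMul 1 D))

theorem strictTransform_nonneg {D : WeilDivisor Y ℤ} (hD : 0 ≤ D) : 0 ≤ strictTransform f D :=
  fun x ↦ Int.floor_nonneg.2 <| pushforward_nonneg f.symm
    (fun y ↦ mul_nonneg zero_le_one (Int.cast_nonneg (hD y))) x

theorem floor_ratSMul_one (D : WeilDivisor Y ℤ) : floor (ratSMul 1 D) = D :=
  Subtype.ext <| Function.locallyFinsuppWithin.ext fun y ↦
    (congrArg Int.floor (one_mul (D.1 y : ℚ))).trans (Int.floor_intCast _)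

theorem restrict_strictTransform (D : WeilDivisor Y ℤ) :
    restrict (f.iso.inv ≫ f.source.ι) (strictTransform f D) = restrict f.target.ι D :=
  calc restrict (f.iso.inv ≫ f.source.ι) (strictTransform f D)
    _ = floor (restrict f.iso.inv (restrict f.source.ι (pushforward f.symm (ratSMul 1 D)))) := rfl
    _ = floor (restrict f.iso.inv (restrict (f.iso.hom ≫ f.target.ι) (ratSMul 1 D))) :=
      congrArg (fun E ↦ floor (restrict f.iso.inv E)) (restrict_pushforward f.symm _)
    _ = restrict (f.iso.inv ≫ f.iso.hom ≫ f.target.ι) (floor (ratSMul 1 D)) := rfl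
    _ = restrict f.target.ι D := by simp only [Iso.inv_hom_id_assoc, floor_ratSMul_one]

end WeilDivisor

theorem mainTheorem11_general (X Y : Scheme.{u}) [IsIntegral X] [IsLocallyNoetherian X]
    [IsNagataScheme X] [IsIntegral Y] [IsLocallyNoetherian Y] [IsNormalScheme Y]
    (Δ : WeilDivisor X ℚ) (hX : IsStronglyGloballyPlusRegular X Δ) (f : X.PartialIso Y)
    (hf : ∀ y : Y, y ∉ f.target → 2 ≤ coheight y) :
    IsStronglyGloballyPlusRegular Y (WeilDivisor.pushforward f Δ) := by
  intro D hD
  obtain ⟨ε, hε, hreg⟩ := hX _ (WeilDivisor.strictTransform_nonneg f hD)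
  have : Nonempty f.target := f.dense_target.nonempty.to_subtype
  have hcodim (y : Y) (hy : coheight y = 1) : y ∈ Set.range f.target.ι := by
    rw [Scheme.Opens.range_ι]
    exact by_contra fun hyf ↦ absurd (hy ▸ hf y hyf) (by norm_num)
  refine ⟨ε, hε, hreg.of_restrict_eq (a := f.iso.inv ≫ f.source.ι) hcodim ?_⟩
  rw [WeilDivisor.restrict_add, WeilDivisor.restrict_add, WeilDivisor.restrict_ratSMul,
    WeilDivisor.restrict_ratSMul, WeilDivisor.restrict_strictTransform,
    WeilDivisor.restrict_pushforward]

end PlusRegular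

end

theorem mainTheorem11 (X Y : Scheme.{u})
    [IsIntegral X] [IsLocallyNoetherian X] [PlusRegular.IsNormalScheme X]
    [PlusRegular.IsNagataScheme X]
    [IsIntegral Y] [IsLocallyNoetherian Y] [PlusRegular.IsNormalScheme Y]
    (Δ : PlusRegular.WeilDivisor X ℚ)
    (hX : PlusRegular.IsStronglyGloballyPlusRegular X Δ)
    (f : X.PartialIso Y) (hf : PlusRegular.IsSmall f) :
    PlusRegular.IsStronglyGloballyPlusRegular Y (PlusRegular.WeilDivisor.pushforward f Δ) :=
  PlusRegular.mainTheorem11_general X Y Δ hX f hf.2
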